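/- **Setting.** Let $K$ be a connected compact metrizable space, $N\ge 2$, $S=\{1,\dots,N\}$, $\psi_i\colon K\to K$ ($i\in S$) continuous injective maps, and $\pi\colon S^{\mathbb N}\to K$ a continuous surjection with $\psi_i(\pi(\omega_1\omega_2\cdots))=\pi(i\omega_1\omega_2\cdots)$ for all $i\in S$. Put $K_i=\psi_i(K)$, $\mathcal P=\bigcup_{m\ge1}\sigma^m\bigl(\pi^{-1}\bigl(\bigcup_{i\ne j}(K_i\cap K_j)\bigr)\bigr)$, with $\sigma$ the left shift, and $V_0=\pi(\mathcal P)$. Assume that $\mathcal P$ is finite (post-critical finiteness). For a word $w=w_1\cdots w_m\in S^m$ let $\psi_w=\psi_{w_1}\circ\cdots\circ\psi_{w_m}$, and let $V_m=\bigcup_{w\in S^m}\psi_w(V_0)$. Let $D$ be a symmetric real matrix indexed by $V_0$ that is nonpositive definite, satisfies $Du=0$ if and only if $u$ is constant, and has nonnegative off-diagonal entries; let $0<r_i<1$ for $i\in S$, and $r_w=r_{w_1}\cdots r_{w_m}$. Put $\mathcal E^{(0)}(u,v)=\sum_{q\in V_0}(-Du)(q)\,v(q)$ and $$\mathcal E^{(m)}(u,v)=\sum_{w\in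 S^m}\frac1{r_w}\,\mathcal E^{(0)}(u\circ\psi_w|_{V_0},v\circ\psi_w|_{V_0}).$$ Assume that $(D,\{r_i\}_{i\in S})$ is a (regular) harmonic structure: $\mathcal E^{(0)}(v,v)=\inf\{\mathcal E^{(1)}(u,u): u\colon V_1\to\mathbb R,\ u|_{V_0}=v\}$ for every $v\colon V_0\to\mathbb R$. Let $\mathcal F$ be the set of all $u\in C(K)$ with $\lim_{m\to\infty}\mathcal E^{(m)}(u,u)<\infty$, and $\mathcal E(u,v)=\lim_{m\to\infty}\mathcal E^{(m)}(u,v)$ for $u,v\in\mathcal F$. (For every Borel probability measure $\mu$ of full support this is a regular Dirichlet form on $L^2(K,\mu)$; nothing below depends on $\mu$.) For $f\in\mathcal F$ the energy measure $\nu_f$ is the finite positive Borel measure on $K$ with $\int_K\varphi\,d\nu_f=2\mathcal E(f\varphi,f)-\mathcal E(\varphi,f^2)$ for all $\varphi\in\mathcal F$, and $\nu_{f,g}=\frac12(\nu_{f+g}-\nu_f-\nu_g)$. A $\sigma$-finite Borel measure $\nu$ is minimal energy-dominant if $\nu_f\ll\nu$ for all $f\in\mathcal F$, and $\nu\ll\nu'$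 for every $\sigma$-finite Borel measure $\nu'$ that also satisfies $\nu_f\ll\nu'$ for all $f\in\mathcal F$. Fix a finite minimal energy-dominant measure $\nu$. The pointwise index is the ($\nu$-a.e. unique) measurable function $p(\cdot)\colon K\to\{0,1,2,\dots\}\cup\{\infty\}$ such that * (a) for all $n$ and $f_1,\dots,f_n\in\mathcal F$, $\operatorname{rank}\bigl(\frac{d\nu_{f_i,f_j}}{d\nu}(x)\bigr)_{i,j=1}^n\le p(x)$ for $\nu$-a.e. $x$; * (b) $p(x)\le p'(x)$ for $\nu$-a.e. $x$ whenever $p'(\cdot)$ is another function that satisfies (a). The index of $(\mathcal E,\mathcal F)$ is $\nu\text{-}\operatorname{ess\,sup}_{x\in K}p(x)$. For $q\in V_0$ let $h_q\in\mathcal F$ be the harmonic function with $h_q(q)=1$ and $h_q=0$ on $V_0\setminus\{q\}$, that is, the unique minimizer of $\mathcal E(g,g)$ among the $g\in\mathcal F$ with these values on $V_0$. For $q,q'\in V_0$ let $Z^{q,q'}=d\nu_{h_q,h_{q'}}/d\nu$. **Proposition.** The index of $(\mathcal E,\mathcal F)$ is $\ \nu\text{-}\operatorname{ess\,sup}_{x\in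 K}\operatorname{rank}\bigl(Z^{q,q'}(x)\bigr)_{q,q'\in V_0}$. -/

import Mathlib

open MeasureTheory Filter Topology

noncomputable section

/-! ## Energy measures, minimal energy-dominant measures and the index

On a compact space, for a symmetric form whose domain consists of continuous functions. -/

/-- The raw data of a symmetric form `(E, F)` on a compact space `K`, with domain `F ⊆ C(K)`. The
values of `form` are only relevant on `dom`. If `μ` is a finite Borel measure of full support, then
`C(K)` embeds in `L²(K, μ)` and `F` is viewed as a subspace of `L²(K, μ)`; energy measures and the
index do not involve `μ`. This is only a container: the form to which it is applied
is constructed below, in `HarmonicStructure.dirichletForm`. -/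
structure ContinuousForm (K : Type*) [TopologicalSpace K] where
  dom : Set C(K, ℝ)
  form : C(K, ℝ) → C(K, ℝ) → ℝ

namespace ContinuousForm

variable {K : Type*} [TopologicalSpace K] [MeasurableSpace K]

/-- The identity that determines the energy measure of `f`:
`∫ φ dν = 2 E(f φ, f) - E(φ, f ^ 2)` for all `φ` in `F ∩ C₀(K) = F`. -/
def IsEnergyMeasure (E : ContinuousForm K) (f : C(K, ℝ)) (ν : FiniteMeasure K) : Prop :=
  ∀ φ ∈ E.dom, ∫ x, φ x ∂(ν : Measure K) = 2 * E.form (f * φ) f - E.form φ (f ^ 2)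

open Classical in
/-- The energy measure `ν_f` (the zero measure should no such measure exist). -/
def energyMeasure (E : ContinuousForm K) (f : C(K, ℝ)) : FiniteMeasure K :=
  if h : ∃ ν : FiniteMeasure K, E.IsEnergyMeasure f ν then h.choose else 0

/-- The mutual energy measure `ν_{f,g} = (ν_{f+g} - ν_f - ν_g) / 2`, a signed measure. -/
def mutualEnergyMeasure (E : ContinuousForm K) (f g : C(K, ℝ)) : SignedMeasure K :=
  (1 / 2 : ℝ) • ((E.energyMeasure (f + g) : Measure K).toSignedMeasure
    - (E.energyMeasure f : Measure K).toSignedMeasure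
    - (E.energyMeasure g : Measure K).toSignedMeasure)

/-- `ν_f ≪ ν` for every `f` in the domain. -/
def IsEnergyDominant (E : ContinuousForm K) (ν : Measure K) : Prop :=
  ∀ f ∈ E.dom, (E.energyMeasure f : Measure K) ≪ ν

/-- Minimal energy-dominant measures. -/
structure IsMinimalEnergyDominant (E : ContinuousForm K) (ν : Measure K) : Prop where
  sigmaFinite : SigmaFinite ν
  domination : E.IsEnergyDominant ν
  minimality : ∀ ν' : Measure K, SigmaFinite ν' → E.IsEnergyDominant ν' → ν ≪ ν'

/-- The matrix `(dν_{f_i,f_j}/dν (x))_{i,j}` of Radon-Nikodym derivatives. -/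
def densityMatrix (E : ContinuousForm K) (ν : Measure K) {ι : Type*} (f : ι → C(K, ℝ)) (x : K) :
    Matrix ι ι ℝ :=
  Matrix.of fun i j => (E.mutualEnergyMeasure (f i) (f j)).rnDeriv ν x

/-- The function `p` dominates `ν`-a.e. the rank of every finite density matrix. -/
def DominatesRanks (E : ContinuousForm K) (ν : Measure K) (p : K → ℕ∞) : Prop :=
  ∀ (N : ℕ) (f : Fin N → C(K, ℝ)), (∀ i, f i ∈ E.dom) →
    ∀ᵐ x ∂ν, ((E.densityMatrix ν f x).rank : ℕ∞) ≤ p x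

/-- `p` is (a version of) the pointwise index, relative to the measure `ν`. -/
structure IsPointwiseIndex (E : ContinuousForm K) (ν : Measure K) (p : K → ℕ∞) : Prop where
  measurable : Measurable p
  dominates : E.DominatesRanks ν p
  minimal : ∀ p' : K → ℕ∞, E.DominatesRanks ν p' → ∀ᵐ x ∂ν, p x ≤ p' x

/-- `n` is the index: the pointwise index exists (it is then `ν`-a.e. unique) and its
`ν`-essential supremum is `n`. -/
def HasIndex (E : ContinuousForm K) (ν : Measure K) (n : ℕ∞) : Prop :=
  ∃ p : K → ℕ∞, E.IsPointwiseIndex ν p ∧ essSup p ν = n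

end ContinuousForm

/-! ## Post-critically finite self-similar structures -/

/-- The one-sided infinite word `i ω₀ ω₁ …`. -/
def wordCons {S : Type*} (i : S) (ω : ℕ → S) : ℕ → S
  | 0 => i
  | n + 1 => ω n

/-- A self-similar structure on `K` with `N` maps. The space `ℕ → Fin N` of infinite words carries
the product of the discrete topologies. -/
structure SelfSimilarStructure (K : Type*) [TopologicalSpace K] (N : ℕ) where
  ψ : Fin N → K → K
  continuous_ψ : ∀ i, Continuous (ψ i)
  injective_ψ : ∀ i, Function.Injective (ψ i)
  π : (ℕ → Fin N) → K
  continuous_π : Continuous π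
  surjective_π : Function.Surjective π
  ψ_π : ∀ i ω, ψ i (π ω) = π (wordCons i ω)

namespace SelfSimilarStructure

variable {K : Type*} [TopologicalSpace K] {N : ℕ}

/-- `ψ_w = ψ_{w₁} ∘ ⋯ ∘ ψ_{w_m}` for a word `w` of length `m`. -/
def wordMap (L : SelfSimilarStructure K N) : (m : ℕ) → (Fin m → Fin N) → K → K
  | 0, _ => id
  | m + 1, w => L.ψ (w 0) ∘ L.wordMap m (Fin.tail w)

/-- The set of the infinite words coding a point in two different cells `K_i = ψ_i(K)`. -/
def criticalSet (L : SelfSimilarStructure K N) : Set (ℕ → Fin N) :=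
  L.π ⁻¹' {x | ∃ i j, i ≠ j ∧ x ∈ Set.range (L.ψ i) ∩ Set.range (L.ψ j)}

/-- The post-critical set: the `m`-fold left shifts, `m ≥ 1`, of the critical words. -/
def postCriticalSet (L : SelfSimilarStructure K N) : Set (ℕ → Fin N) :=
  {ω | ∃ m : ℕ, 1 ≤ m ∧ ∃ τ ∈ L.criticalSet, ω = fun n => τ (n + m)}

/-- The boundary `V₀`. -/
def V₀ (L : SelfSimilarStructure K N) : Set K := L.π '' L.postCriticalSet

end SelfSimilarStructure

/-- A post-critically finite self-similar structure with at least two maps. -/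
structure PCFStructure (K : Type*) [TopologicalSpace K] (N : ℕ)
    extends SelfSimilarStructure K N where
  two_le : 2 ≤ N
  finite_postCriticalSet : toSelfSimilarStructure.postCriticalSet.Finite

namespace PCFStructure

variable {K : Type*} [TopologicalSpace K] {N : ℕ}

/-- The boundary `V₀`, a finite set. -/
abbrev bdry (L : PCFStructure K N) : Set K := L.toSelfSimilarStructure.V₀

instance (L : PCFStructure K N) : Fintype L.bdry :=
  (L.finite_postCriticalSet.image L.π).fintype

/-- `E⁽⁰⁾(u, v) = (-D u, v)` on functions on `V₀`. -/
def energyZero (L : PCFStructure K N) (D : Matrix L.bdry L.bdry ℝ) (u v : L.bdry → ℝ) : ℝ :=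
  (-(D.mulVec u)) ⬝ᵥ v

/-- `E⁽ᵐ⁾(u, v) = ∑_w r_w⁻¹ E⁽⁰⁾(u ∘ ψ_w, v ∘ ψ_w)`, the sum being over the words `w` of length `m`
and `r_w` being `r_{w₁} ⋯ r_{w_m}`. It depends only on the restrictions of `u` and `v`
to `V_m = ⋃_w ψ_w(V₀)`. -/
def energyLevel (L : PCFStructure K N) (D : Matrix L.bdry L.bdry ℝ) (r : Fin N → ℝ) (m : ℕ)
    (u v : K → ℝ) : ℝ :=
  ∑ w : Fin m → Fin N, (∏ k, r (w k))⁻¹ *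
    L.energyZero D (fun q => u (L.wordMap m w q)) (fun q => v (L.wordMap m w q))

end PCFStructure

/-- A regular harmonic structure `(D, r)` on a p.c.f. self-similar structure. -/
structure HarmonicStructure {K : Type*} [TopologicalSpace K] {N : ℕ} (L : PCFStructure K N) where
  D : Matrix L.bdry L.bdry ℝ
  r : Fin N → ℝ
  symm : D.IsSymm
  nonpos : ∀ u : L.bdry → ℝ, (D.mulVec u) ⬝ᵥ u ≤ 0
  ker : ∀ u : L.bdry → ℝ, D.mulVec u = 0 ↔ ∃ c : ℝ, ∀ q, u q = c
  offDiag_nonneg : ∀ q q', q ≠ q' → 0 ≤ D q q'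
  r_pos : ∀ i, 0 < r i
  /-- `E⁽⁰⁾(v, v) = inf {E⁽¹⁾(u, u) | u = v on V₀}`; since `E⁽¹⁾` sees only the values on `V₁ ⊇ V₀`,
  it is the same to let `u` range over functions on `V₁` or on `K`. -/
  harmonic : ∀ v : L.bdry → ℝ,
    IsGLB {e : ℝ | ∃ u : K → ℝ, (∀ q : L.bdry, u q = v q) ∧ e = L.energyLevel D r 1 u u}
      (L.energyZero D v v)
  /-- Regularity. -/
  r_lt_one : ∀ i, r i < 1

namespace HarmonicStructure

variable {K : Type*} [TopologicalSpace K] {N : ℕ} {L : PCFStructure K N}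

/-- The form associated with `(D, r)`: its domain consists of the continuous functions `u` whose
(nondecreasing) sequence `E⁽ᵐ⁾(u, u)` has a finite limit, and `E(u, v) = lim E⁽ᵐ⁾(u, v)`. -/
def dirichletForm (H : HarmonicStructure L) : ContinuousForm K where
  dom := {u | ∃ e : ℝ, Tendsto (fun m => L.energyLevel H.D H.r m u u) atTop (𝓝 e)}
  form u v := limUnder atTop fun m => L.energyLevel H.D H.r m u v

/-- `h` is harmonic with boundary values `u`: it minimizes the energy among the functions in the
domain that agree with `u` on `V₀`. -/
structure IsHarmonicExtension (H : HarmonicStructure L) (u : L.bdry → ℝ) (h : C(K, ℝ)) :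
    Prop where
  mem_dom : h ∈ H.dirichletForm.dom
  bdry_eq : ∀ q : L.bdry, h q = u q
  minimal : ∀ g ∈ H.dirichletForm.dom, (∀ q : L.bdry, g q = u q) →
    H.dirichletForm.form h h ≤ H.dirichletForm.form g g

open Classical in
/-- The harmonic function with boundary values `u` (zero should none exist). -/
def harmonicExtension (H : HarmonicStructure L) (u : L.bdry → ℝ) : C(K, ℝ) :=
  if h : ∃ f : C(K, ℝ), H.IsHarmonicExtension u f then h.choose else 0

open Classical in
/-- `h_q`: the harmonic function which is `1` at `q` and `0` on the rest of `V₀`. -/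
def harmonicBasis (H : HarmonicStructure L) (q : L.bdry) : C(K, ℝ) :=
  H.harmonicExtension (Pi.single q 1)

end HarmonicStructure

end

/-! The index is computed on the functions whose pull-backs to all cells of level m are harmonic
(`pharm`). They form a finite-dimensional space, and interpolation at level m is an orthogonal
projection in energy, so they approximate every function of the domain (`exists_pharm_approx`).
Convergence in energy gives L¹-convergence of the densities of mutual energy measures, hence a.e.
convergence of density matrices along a subsequence, and rank is lower semicontinuous. Therefore the
supremum over m of the ranks belonging to bases of `pharm m` is a version of the pointwise index
(`isPointwiseIndex_pointwiseIndex`). Level 0 is spanned by the h_q, which gives one inequality.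

The other inequality is self-similarity: ν_f is the sum of r_i⁻¹ times the image under ψ_i of
ν_{f∘ψ_i} (`energyMeasure_eq_sum`). Off the overlap of the cells, the density matrix of (f_a) at
ψ_i(y) is thus a scalar multiple of that of (f_a∘ψ_i) at y, and a constant a.e. bound on the ranks
for all pull-backs is one for (f_a) (`rank_densityMatrix_le_of_pull`). Induction on m reduces to
harmonic functions.

Null sets can be moved between K and its cells because ν is minimal: it is dominated by the sum of
its images (`null_of_preimage_null`) and has no atoms, so the finite overlap is negligible. Atoms
are excluded since ν_f{x} depends only on f near x; f may be replaced by its truncation to [f(x) -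
ε, f(x) + ε], whose energy tends to 0 (`nm_singleton`).

Harmonic functions are built by iterating the minimal extension from V₀ to V₁ along words, where r_i
< 1 forces convergence; energy measures are weak limits of discrete ones. -/

noncomputable section

namespace HarmonicStructure

variable {K : Type*} [TopologicalSpace K] {N : ℕ} {L : PCFStructure K N}

/-! ## Elementary properties of the discrete energies -/

lemma sum_row_eq_zero (H : HarmonicStructure L) (p : L.bdry) : ∑ q, H.D p q = 0 := by
  have h := (H.ker (fun _ => 1)).2 ⟨1, fun _ => rfl⟩
  simpa [Matrix.mulVec, dotProduct] using congrFun h p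

lemma sum_col_eq_zero (H : HarmonicStructure L) (q : L.bdry) : ∑ p, H.D p q = 0 := by
  rw [← H.sum_row_eq_zero q]
  exact Finset.sum_congr rfl fun p _ => H.symm.apply q p

open Classical in
/-- The conductance of an edge of the level zero graph. -/
def cond (H : HarmonicStructure L) (p q : L.bdry) : ℝ := if p = q then 0 else H.D p q / 2

lemma cond_nonneg (H : HarmonicStructure L) (p q : L.bdry) : 0 ≤ H.cond p q := by
  unfold cond
  split_ifs with h
  · exact le_rfl
  · have := H.offDiag_nonneg p q h
    positivity

/-- Rows and columns of D sum to zero, so the terms in `u p * v p` and `u q * v q` drop out. The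
half in `cond` compensates for counting every edge in both directions. -/
lemma energyZero_eq (H : HarmonicStructure L) (u v : L.bdry → ℝ) :
    L.energyZero H.D u v = ∑ p, ∑ q, H.cond p q * ((u p - u q) * (v p - v q)) := by
  have h1 : ∀ p q, H.cond p q * ((u p - u q) * (v p - v q))
      = H.D p q * (u p * v p) / 2 + H.D p q * (u q * v q) / 2
        - H.D p q * u q * v p / 2 - H.D p q * u p * v q / 2 := by
    intro p q
    unfold cond
    split_ifs with h
    · subst h; ring
    · ring
  have h2 : ∑ p, ∑ q, H.D p q * (u p * v p) / 2 = 0 := by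
    refine Finset.sum_eq_zero fun p _ => ?_
    rw [← Finset.sum_div, ← Finset.sum_mul, H.sum_row_eq_zero]; simp
  have h3 : ∑ p, ∑ q, H.D p q * (u q * v q) / 2 = 0 := by
    rw [Finset.sum_comm]
    refine Finset.sum_eq_zero fun p _ => ?_
    rw [← Finset.sum_div, ← Finset.sum_mul, H.sum_col_eq_zero]; simp
  have h4 : ∑ p, ∑ q, H.D p q * u p * v q / 2 = ∑ p, ∑ q, H.D p q * u q * v p / 2 := by
    rw [Finset.sum_comm]
    refine Finset.sum_congr rfl fun p _ => Finset.sum_congr rfl fun q _ => ?_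
    rw [H.symm.apply]
  simp_rw [h1, Finset.sum_sub_distrib, Finset.sum_add_distrib]
  rw [h2, h3, h4]
  simp only [PCFStructure.energyZero, dotProduct, Matrix.mulVec, Pi.neg_apply]
  rw [zero_add, zero_sub, ← neg_add', ← Finset.sum_add_distrib, ← Finset.sum_neg_distrib]
  refine Finset.sum_congr rfl fun p _ => ?_
  rw [← Finset.sum_add_distrib, neg_mul, Finset.sum_mul]
  congr 1
  refine Finset.sum_congr rfl fun q _ => ?_
  ring

/-- The discrete energy of level `m`. -/
abbrev En (H : HarmonicStructure L) (m : ℕ) (u v : K → ℝ) : ℝ := L.energyLevel H.D H.r m u v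

lemma En_zero (H : HarmonicStructure L) (u v : K → ℝ) :
    H.En 0 u v = L.energyZero H.D (fun q => u q) (fun q => v q) := by
  simp [En, PCFStructure.energyLevel, SelfSimilarStructure.wordMap]

lemma En_succ (H : HarmonicStructure L) (m : ℕ) (u v : K → ℝ) :
    H.En (m + 1) u v = ∑ i, (H.r i)⁻¹ * H.En m (u ∘ L.ψ i) (v ∘ L.ψ i) := by
  simp only [En, PCFStructure.energyLevel]
  rw [← (Fin.consEquiv (fun _ => Fin N)).sum_comp, Fintype.sum_prod_type]
  refine Finset.sum_congr rfl fun i _ => ?_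
  rw [Finset.mul_sum]
  refine Finset.sum_congr rfl fun w _ => ?_
  simp only [Fin.consEquiv, Equiv.coe_fn_mk, Fin.prod_univ_succ, Fin.cons_zero, Fin.cons_succ,
    mul_inv, mul_assoc, SelfSimilarStructure.wordMap, Fin.tail_cons]
  rfl

/-- The edges of the graph of level `m`. -/
abbrev Edge (L : PCFStructure K N) (m : ℕ) := (Fin m → Fin N) × L.bdry × L.bdry

/-- The conductance of an edge of level `m`. -/
def wt (H : HarmonicStructure L) (m : ℕ) (e : Edge L m) : ℝ :=
  (∏ k, H.r (e.1 k))⁻¹ * H.cond e.2.1 e.2.2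

/-- The initial point of an edge. -/
def src (m : ℕ) (e : Edge L m) : K := L.wordMap m e.1 e.2.1

/-- The end point of an edge. -/
def tgt (m : ℕ) (e : Edge L m) : K := L.wordMap m e.1 e.2.2

lemma wt_nonneg (H : HarmonicStructure L) (m : ℕ) (e : Edge L m) : 0 ≤ H.wt m e :=
  mul_nonneg (inv_nonneg.2 (Finset.prod_nonneg fun _ _ => (H.r_pos _).le)) (H.cond_nonneg _ _)

lemma En_eq (H : HarmonicStructure L) (m : ℕ) (u v : K → ℝ) :
    H.En m u v = ∑ e : Edge L m,
      H.wt m e * ((u (src m e) - u (tgt m e)) * (v (src m e) - v (tgt m e))) := by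
  rw [Fintype.sum_prod_type]
  refine Finset.sum_congr rfl fun w _ => ?_
  rw [energyZero_eq, Fintype.sum_prod_type, Finset.mul_sum]
  refine Finset.sum_congr rfl fun p _ => ?_
  rw [Finset.mul_sum]
  refine Finset.sum_congr rfl fun q _ => ?_
  simp only [wt, src, tgt]
  ring

lemma En_comm (H : HarmonicStructure L) (m : ℕ) (u v : K → ℝ) : H.En m u v = H.En m v u := by
  rw [En_eq, En_eq]
  exact Finset.sum_congr rfl fun e _ => by ring

lemma En_nonneg (H : HarmonicStructure L) (m : ℕ) (u : K → ℝ) : 0 ≤ H.En m u u := by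
  rw [En_eq]
  exact Finset.sum_nonneg fun e _ => mul_nonneg (H.wt_nonneg m e) (mul_self_nonneg _)

lemma En_add_left (H : HarmonicStructure L) (m : ℕ) (u u' v : K → ℝ) :
    H.En m (u + u') v = H.En m u v + H.En m u' v := by
  simp only [En_eq, ← Finset.sum_add_distrib, Pi.add_apply]
  exact Finset.sum_congr rfl fun e _ => by ring

lemma En_smul_left (H : HarmonicStructure L) (m : ℕ) (c : ℝ) (u v : K → ℝ) :
    H.En m (c • u) v = c * H.En m u v := by
  simp only [En_eq, Finset.mul_sum, Pi.smul_apply, smul_eq_mul]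
  exact Finset.sum_congr rfl fun e _ => by ring

lemma En_add_right (H : HarmonicStructure L) (m : ℕ) (u v v' : K → ℝ) :
    H.En m u (v + v') = H.En m u v + H.En m u v' := by
  rw [En_comm, En_add_left, En_comm _ _ v, En_comm _ _ v']

lemma En_smul_right (H : HarmonicStructure L) (m : ℕ) (c : ℝ) (u v : K → ℝ) :
    H.En m u (c • v) = c * H.En m u v := by
  rw [En_comm, En_smul_left, En_comm]

lemma En_sub_left (H : HarmonicStructure L) (m : ℕ) (u u' v : K → ℝ) :
    H.En m (u - u') v = H.En m u v - H.En m u' v := by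
  simp only [En_eq, ← Finset.sum_sub_distrib, Pi.sub_apply]
  exact Finset.sum_congr rfl fun e _ => by ring

lemma En_sub_right (H : HarmonicStructure L) (m : ℕ) (u v v' : K → ℝ) :
    H.En m u (v - v') = H.En m u v - H.En m u v' := by
  rw [En_comm, En_sub_left, En_comm _ _ v, En_comm _ _ v']

/-- The weighted Young inequality. -/
lemma two_mul_abs_En_le (H : HarmonicStructure L) (m : ℕ) (u v : K → ℝ) {t : ℝ} (ht : 0 < t) :
    2 * |H.En m u v| ≤ t * H.En m u u + t⁻¹ * H.En m v v := by
  have key : ∀ s : ℝ, s ^ 2 = 1 → 2 * (s * H.En m u v) ≤ t * H.En m u u + t⁻¹ * H.En m v v := by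
    intro s hs
    have h0 := H.En_nonneg m (t • u - s • v)
    simp only [En_sub_left, En_sub_right, En_smul_left, En_smul_right, H.En_comm m v u] at h0
    have h1 : 0 ≤ t⁻¹ * (t * (t * H.En m u u) - s * (t * H.En m u v)
        - (t * (s * H.En m u v) - s * (s * H.En m v v))) :=
      mul_nonneg (inv_nonneg.2 ht.le) (by linarith)
    have h2 : t⁻¹ * (t * (t * H.En m u u) - s * (t * H.En m u v)
        - (t * (s * H.En m u v) - s * (s * H.En m v v)))
        = t * H.En m u u - 2 * (s * H.En m u v) + t⁻¹ * (s ^ 2 * H.En m v v) := by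
      field_simp
      ring
    rw [h2, hs] at h1
    linarith
  rcases abs_cases (H.En m u v) with ⟨h, _⟩ | ⟨h, _⟩ <;> rw [h]
  · simpa using key 1 (by norm_num)
  · simpa using key (-1) (by norm_num)

lemma En_const_left (H : HarmonicStructure L) (m : ℕ) (c : ℝ) (v : K → ℝ) :
    H.En m (fun _ => c) v = 0 := by
  simp [En_eq]

lemma En_zero_le_one (H : HarmonicStructure L) (u : K → ℝ) : H.En 0 u u ≤ H.En 1 u u := by
  rw [En_zero]
  exact (H.harmonic fun q => u q).1 ⟨u, fun _ => rfl, rfl⟩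

/-- The harmonic structure gives the step from 0 to 1; the splitting over first letters carries it
to all levels. -/
lemma En_le_succ (H : HarmonicStructure L) (m : ℕ) (u : K → ℝ) :
    H.En m u u ≤ H.En (m + 1) u u := by
  induction m generalizing u with
  | zero => exact H.En_zero_le_one u
  | succ m ih =>
    rw [H.En_succ m, H.En_succ (m + 1)]
    exact Finset.sum_le_sum fun i _ =>
      mul_le_mul_of_nonneg_left (ih _) (inv_nonneg.2 (H.r_pos i).le)

lemma En_mono (H : HarmonicStructure L) (u : K → ℝ) : Monotone fun m => H.En m u u :=
  monotone_nat_of_le_succ fun m => H.En_le_succ m u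

/-! ## The domain -/

lemma mem_dom_iff (H : HarmonicStructure L) (u : C(K, ℝ)) :
    u ∈ H.dirichletForm.dom ↔ ∃ B, ∀ m, H.En m u u ≤ B := by
  constructor
  · rintro ⟨e, he⟩
    exact ⟨e, fun m => (H.En_mono u).ge_of_tendsto he m⟩
  · rintro ⟨B, hB⟩
    exact ⟨_, tendsto_atTop_ciSup (H.En_mono u) ⟨B, by rintro _ ⟨m, rfl⟩; exact hB m⟩⟩

lemma add_mem_dom (H : HarmonicStructure L) {u v : C(K, ℝ)} (hu : u ∈ H.dirichletForm.dom)
    (hv : v ∈ H.dirichletForm.dom) : u + v ∈ H.dirichletForm.dom := by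
  rw [mem_dom_iff] at *
  obtain ⟨B, hB⟩ := hu
  obtain ⟨B', hB'⟩ := hv
  refine ⟨2 * (B + B'), fun m => ?_⟩
  -- Parallelogram law: the energy of the sum is at most twice the sum of the energies.
  have h := H.En_nonneg m ((u : K → ℝ) - v)
  simp only [ContinuousMap.coe_add, En_add_left, En_add_right, En_sub_left, En_sub_right] at h ⊢
  linarith [hB m, hB' m]

lemma smul_mem_dom (H : HarmonicStructure L) (c : ℝ) {u : C(K, ℝ)}
    (hu : u ∈ H.dirichletForm.dom) : c • u ∈ H.dirichletForm.dom := by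
  rw [mem_dom_iff] at *
  obtain ⟨B, hB⟩ := hu
  refine ⟨c * c * B, fun m => ?_⟩
  rw [ContinuousMap.coe_smul, En_smul_left, En_smul_right, ← mul_assoc]
  exact mul_le_mul_of_nonneg_left (hB m) (mul_self_nonneg c)

lemma const_mem_dom (H : HarmonicStructure L) (c : ℝ) :
    ContinuousMap.const K c ∈ H.dirichletForm.dom := by
  rw [mem_dom_iff]
  exact ⟨0, fun m => (H.En_const_left m c _).le⟩

lemma one_mem_dom (H : HarmonicStructure L) : (1 : C(K, ℝ)) ∈ H.dirichletForm.dom :=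
  H.const_mem_dom 1

/-- The domain as a linear subspace of `C(K)`. -/
def domSubmodule (H : HarmonicStructure L) : Submodule ℝ C(K, ℝ) where
  carrier := H.dirichletForm.dom
  add_mem' := H.add_mem_dom
  zero_mem' := H.const_mem_dom 0
  smul_mem' := fun c _ => H.smul_mem_dom c

lemma sub_mem_dom (H : HarmonicStructure L) {u v : C(K, ℝ)} (hu : u ∈ H.dirichletForm.dom)
    (hv : v ∈ H.dirichletForm.dom) : u - v ∈ H.dirichletForm.dom :=
  H.domSubmodule.sub_mem hu hv

/-- `form` is a `limUnder`, meaningful only once convergence is known. Polarization reduces this to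
the quadratic case. -/
lemma tendsto_form (H : HarmonicStructure L) {u v : C(K, ℝ)} (hu : u ∈ H.dirichletForm.dom)
    (hv : v ∈ H.dirichletForm.dom) :
    Tendsto (fun m => H.En m u v) atTop (𝓝 (H.dirichletForm.form u v)) := by
  obtain ⟨a, ha⟩ := H.add_mem_dom hu hv
  obtain ⟨b, hb⟩ := H.sub_mem_dom hu hv
  have h : Tendsto (fun m => H.En m u v) atTop (𝓝 ((a - b) / 4)) := by
    refine ((ha.sub hb).div_const 4).congr fun m => ?_
    simp only [ContinuousMap.coe_add, ContinuousMap.coe_sub, En_add_left, En_add_right,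
      En_sub_left, En_sub_right, H.En_comm m v u]
    ring
  exact tendsto_nhds_limUnder ⟨_, h⟩

lemma En_le_form (H : HarmonicStructure L) {u : C(K, ℝ)} (hu : u ∈ H.dirichletForm.dom) (m : ℕ) :
    H.En m u u ≤ H.dirichletForm.form u u :=
  (H.En_mono u).ge_of_tendsto (H.tendsto_form hu hu) m

lemma form_eq_of_eventually (H : HarmonicStructure L) {u v : C(K, ℝ)} {e : ℝ}
    (h : ∀ᶠ m in atTop, H.En m u v = e) : H.dirichletForm.form u v = e :=
  (tendsto_const_nhds.congr' (h.mono fun _ hm => hm.symm)).limUnder_eq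

lemma form_nonneg (H : HarmonicStructure L) {u : C(K, ℝ)} (hu : u ∈ H.dirichletForm.dom) :
    0 ≤ H.dirichletForm.form u u :=
  (H.En_nonneg 0 u).trans (H.En_le_form hu 0)

lemma form_comm (H : HarmonicStructure L) (u v : C(K, ℝ)) :
    H.dirichletForm.form u v = H.dirichletForm.form v u := by
  simp only [dirichletForm]
  congr 1
  ext m
  exact H.En_comm m u v

lemma form_add_left (H : HarmonicStructure L) {u u' v : C(K, ℝ)} (hu : u ∈ H.dirichletForm.dom)
    (hu' : u' ∈ H.dirichletForm.dom) (hv : v ∈ H.dirichletForm.dom) :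
    H.dirichletForm.form (u + u') v = H.dirichletForm.form u v + H.dirichletForm.form u' v := by
  refine tendsto_nhds_unique (H.tendsto_form (H.add_mem_dom hu hu') hv) ?_
  refine ((H.tendsto_form hu hv).add (H.tendsto_form hu' hv)).congr fun m => ?_
  rw [ContinuousMap.coe_add, En_add_left]

lemma form_smul_left (H : HarmonicStructure L) (c : ℝ) {u v : C(K, ℝ)}
    (hu : u ∈ H.dirichletForm.dom) (hv : v ∈ H.dirichletForm.dom) :
    H.dirichletForm.form (c • u) v = c * H.dirichletForm.form u v := by
  refine tendsto_nhds_unique (H.tendsto_form (H.smul_mem_dom c hu) hv) ?_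
  refine ((H.tendsto_form hu hv).const_mul c).congr fun m => ?_
  rw [ContinuousMap.coe_smul, En_smul_left]

lemma form_add_right (H : HarmonicStructure L) {u v v' : C(K, ℝ)} (hu : u ∈ H.dirichletForm.dom)
    (hv : v ∈ H.dirichletForm.dom) (hv' : v' ∈ H.dirichletForm.dom) :
    H.dirichletForm.form u (v + v') = H.dirichletForm.form u v + H.dirichletForm.form u v' := by
  rw [form_comm, H.form_add_left hv hv' hu, form_comm, H.form_comm v']

lemma form_smul_right (H : HarmonicStructure L) (c : ℝ) {u v : C(K, ℝ)}
    (hu : u ∈ H.dirichletForm.dom) (hv : v ∈ H.dirichletForm.dom) :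
    H.dirichletForm.form u (c • v) = c * H.dirichletForm.form u v := by
  rw [form_comm, H.form_smul_left c hv hu, form_comm]

/-- The free parameter stands in for Cauchy–Schwarz: a large t is affordable when the energy of u is
small, and damps the energy of v. -/
lemma two_mul_abs_form_le (H : HarmonicStructure L) {u v : C(K, ℝ)}
    (hu : u ∈ H.dirichletForm.dom) (hv : v ∈ H.dirichletForm.dom) {t : ℝ} (ht : 0 < t) :
    2 * |H.dirichletForm.form u v|
      ≤ t * H.dirichletForm.form u u + t⁻¹ * H.dirichletForm.form v v :=
  le_of_tendsto_of_tendsto' ((H.tendsto_form hu hv).abs.const_mul 2)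
    (((H.tendsto_form hu hu).const_mul t).add ((H.tendsto_form hv hv).const_mul t⁻¹))
    fun m => H.two_mul_abs_En_le m u v ht

lemma mul_mem_dom [CompactSpace K] (H : HarmonicStructure L) {u v : C(K, ℝ)}
    (hu : u ∈ H.dirichletForm.dom) (hv : v ∈ H.dirichletForm.dom) :
    u * v ∈ H.dirichletForm.dom := by
  rw [mem_dom_iff] at *
  obtain ⟨B, hB⟩ := hu
  obtain ⟨B', hB'⟩ := hv
  refine ⟨2 * ‖u‖ ^ 2 * B' + 2 * ‖v‖ ^ 2 * B, fun m => ?_⟩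
  have h : H.En m (u * v : C(K, ℝ)) (u * v : C(K, ℝ))
      ≤ 2 * ‖u‖ ^ 2 * H.En m v v + 2 * ‖v‖ ^ 2 * H.En m u u := by
    simp only [En_eq, Finset.mul_sum, ← Finset.sum_add_distrib]
    refine Finset.sum_le_sum fun e _ => ?_
    have hu1 := u.norm_coe_le_norm (src m e)
    have hv1 := v.norm_coe_le_norm (tgt m e)
    rw [Real.norm_eq_abs] at hu1 hv1
    have hu2 := sq_le_sq' (by linarith [abs_nonneg (u (src m e)), neg_le_abs (u (src m e))])
      ((le_abs_self _).trans hu1)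
    have hv2 := sq_le_sq' (by linarith [abs_nonneg (v (tgt m e)), neg_le_abs (v (tgt m e))])
      ((le_abs_self _).trans hv1)
    simp only [ContinuousMap.coe_mul, Pi.mul_apply]
    set a := u (src m e)
    set b := u (tgt m e)
    set c := v (src m e)
    set d := v (tgt m e)
    -- Leibniz splitting: ac - bd = a(c - d) + d(a - b).
    have h1 : (a * c - b * d) * (a * c - b * d)
        ≤ 2 * (a ^ 2 * (c - d) ^ 2) + 2 * (d ^ 2 * (a - b) ^ 2) := by
      nlinarith [sq_nonneg (a * (c - d) - d * (a - b))]
    have h2 : a ^ 2 * (c - d) ^ 2 ≤ ‖u‖ ^ 2 * (c - d) ^ 2 :=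
      mul_le_mul_of_nonneg_right hu2 (sq_nonneg _)
    have h3 : d ^ 2 * (a - b) ^ 2 ≤ ‖v‖ ^ 2 * (a - b) ^ 2 :=
      mul_le_mul_of_nonneg_right hv2 (sq_nonneg _)
    calc H.wt m e * ((a * c - b * d) * (a * c - b * d))
        ≤ H.wt m e * (2 * (‖u‖ ^ 2 * (c - d) ^ 2) + 2 * (‖v‖ ^ 2 * (a - b) ^ 2)) :=
          mul_le_mul_of_nonneg_left (by linarith) (H.wt_nonneg m e)
      _ = _ := by ring
  refine h.trans (add_le_add ?_ ?_)
  · exact mul_le_mul_of_nonneg_left (hB' m) (by positivity)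
  · exact mul_le_mul_of_nonneg_left (hB m) (by positivity)

lemma sq_mem_dom [CompactSpace K] (H : HarmonicStructure L) {u : C(K, ℝ)}
    (hu : u ∈ H.dirichletForm.dom) : u ^ 2 ∈ H.dirichletForm.dom := by
  rw [sq]; exact H.mul_mem_dom hu hu

/-! ## Self-similarity of the form -/

/-- The pull-back `u ∘ ψ_i` of a continuous function. -/
def pull (L : PCFStructure K N) (i : Fin N) : C(K, ℝ) →ₗ[ℝ] C(K, ℝ) where
  toFun u := u.comp ⟨L.ψ i, L.continuous_ψ i⟩
  map_add' _ _ := rfl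
  map_smul' _ _ := rfl

@[simp] lemma pull_apply (i : Fin N) (u : C(K, ℝ)) (x : K) : pull L i u x = u (L.ψ i x) := rfl

lemma coe_pull (i : Fin N) (u : C(K, ℝ)) : (pull L i u : K → ℝ) = u ∘ L.ψ i := rfl

lemma pull_mul (i : Fin N) (u v : C(K, ℝ)) : pull L i (u * v) = pull L i u * pull L i v := rfl

lemma En_pull_le (H : HarmonicStructure L) (m : ℕ) (i : Fin N) (u : K → ℝ) :
    H.En m (u ∘ L.ψ i) (u ∘ L.ψ i) ≤ H.r i * H.En (m + 1) u u := by
  rw [En_succ, ← inv_mul_le_iff₀ (H.r_pos i)]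
  exact Finset.single_le_sum (f := fun j => (H.r j)⁻¹ * H.En m (u ∘ L.ψ j) (u ∘ L.ψ j))
    (fun j _ => mul_nonneg (inv_nonneg.2 (H.r_pos j).le) (H.En_nonneg _ _)) (Finset.mem_univ i)

lemma mem_dom_iff_pull (H : HarmonicStructure L) (u : C(K, ℝ)) :
    u ∈ H.dirichletForm.dom ↔ ∀ i, pull L i u ∈ H.dirichletForm.dom := by
  simp only [mem_dom_iff]
  constructor
  · rintro ⟨B, hB⟩ i
    exact ⟨H.r i * B, fun m => (H.En_pull_le m i u).trans
      (mul_le_mul_of_nonneg_left (hB _) (H.r_pos i).le)⟩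
  · intro h
    choose B hB using h
    refine ⟨∑ i, (H.r i)⁻¹ * B i, fun m => (H.En_le_succ m u).trans ?_⟩
    rw [En_succ]
    exact Finset.sum_le_sum fun i _ =>
      mul_le_mul_of_nonneg_left (hB i m) (inv_nonneg.2 (H.r_pos i).le)

lemma pull_mem_dom (H : HarmonicStructure L) {u : C(K, ℝ)} (hu : u ∈ H.dirichletForm.dom)
    (i : Fin N) : pull L i u ∈ H.dirichletForm.dom :=
  (H.mem_dom_iff_pull u).1 hu i

lemma form_eq_sum_pull (H : HarmonicStructure L) {u v : C(K, ℝ)} (hu : u ∈ H.dirichletForm.dom)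
    (hv : v ∈ H.dirichletForm.dom) :
    H.dirichletForm.form u v = ∑ i, (H.r i)⁻¹ * H.dirichletForm.form (pull L i u) (pull L i v) := by
  refine tendsto_nhds_unique ((H.tendsto_form hu hv).comp (tendsto_add_atTop_nat 1)) ?_
  refine (tendsto_finsetSum _ fun i _ => (H.tendsto_form (H.pull_mem_dom hu i)
    (H.pull_mem_dom hv i)).const_mul (H.r i)⁻¹).congr fun m => ?_
  exact (H.En_succ m u v).symm

end HarmonicStructure

/-! ## Words and cells -/

/-- The left shift of a word. -/
def wordTail {S : Type*} (ω : ℕ → S) : ℕ → S := fun n => ω (n + 1)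

@[simp] lemma wordTail_wordCons {S : Type*} (i : S) (ω : ℕ → S) :
    wordTail (wordCons i ω) = ω := rfl

@[simp] lemma wordCons_wordTail {S : Type*} (ω : ℕ → S) : wordCons (ω 0) (wordTail ω) = ω := by
  ext n
  cases n <;> rfl

lemma continuous_wordTail {S : Type*} [TopologicalSpace S] :
    Continuous (wordTail : (ℕ → S) → ℕ → S) :=
  continuous_pi fun n => continuous_apply (n + 1)

namespace PCFStructure

variable {K : Type*} [TopologicalSpace K] {N : ℕ} (L : PCFStructure K N)

lemma ψ_π_wordTail (ω : ℕ → Fin N) : L.ψ (ω 0) (L.π (wordTail ω)) = L.π ω := by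
  rw [L.ψ_π, wordCons_wordTail]

lemma wordTail_mem_postCriticalSet {ω : ℕ → Fin N} (h : ω ∈ L.postCriticalSet) :
    wordTail ω ∈ L.postCriticalSet := by
  obtain ⟨m, hm, τ, hτ, rfl⟩ := h
  refine ⟨m + 1, by omega, τ, hτ, ?_⟩
  ext n
  simp [wordTail, add_comm m 1, add_assoc]

lemma wordTail_mem_of_ne {ω τ : ℕ → Fin N} (h : L.π ω = L.π τ) (h0 : ω 0 ≠ τ 0) :
    wordTail ω ∈ L.postCriticalSet :=
  ⟨1, le_rfl, ω, ⟨ω 0, τ 0, h0, ⟨_, L.ψ_π_wordTail ω⟩, ⟨_, by rw [L.ψ_π_wordTail τ, h]⟩⟩, rfl⟩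

lemma π_wordTail_mem_bdry_of_ne {ω τ : ℕ → Fin N} (h : L.π ω = L.π τ) (h0 : ω 0 ≠ τ 0) :
    L.π (wordTail ω) ∈ L.bdry :=
  ⟨_, L.wordTail_mem_of_ne h h0, rfl⟩

lemma π_wordTail_eq {ω τ : ℕ → Fin N} (h : L.π ω = L.π τ) (h0 : ω 0 = τ 0) :
    L.π (wordTail ω) = L.π (wordTail τ) := by
  apply L.injective_ψ (ω 0)
  rw [L.ψ_π_wordTail, h, h0, L.ψ_π_wordTail]

/-- Only some coding τ of the point need be post-critical. If τ and ω start alike, injectivity of ψ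
identifies the tails; otherwise the point lies in two cells and the tail of ω is post-critical
itself. -/
lemma π_wordTail_mem_bdry {ω : ℕ → Fin N} (h : L.π ω ∈ L.bdry) : L.π (wordTail ω) ∈ L.bdry := by
  obtain ⟨τ, hτ, hτω⟩ := h
  by_cases h0 : ω 0 = τ 0
  · rw [L.π_wordTail_eq hτω.symm h0]
    exact ⟨_, L.wordTail_mem_postCriticalSet hτ, rfl⟩
  · exact L.π_wordTail_mem_bdry_of_ne hτω.symm h0

lemma exists_ψ_eq (x : K) : ∃ i y, L.ψ i y = x := by
  obtain ⟨ω, rfl⟩ := L.surjective_π x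
  exact ⟨_, _, L.ψ_π_wordTail ω⟩

lemma exists_bdry_ψ_eq (q : L.bdry) : ∃ (i : Fin N) (p : L.bdry), L.ψ i p = q := by
  obtain ⟨_, ω, hω, rfl⟩ := q
  exact ⟨ω 0, ⟨_, L.π_wordTail_mem_bdry ⟨ω, hω, rfl⟩⟩, L.ψ_π_wordTail ω⟩

lemma mem_bdry_of_ψ_eq {i j : Fin N} (hij : i ≠ j) {x y : K} (h : L.ψ i x = L.ψ j y) :
    x ∈ L.bdry := by
  obtain ⟨ω, rfl⟩ := L.surjective_π x
  obtain ⟨τ, rfl⟩ := L.surjective_π y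
  rw [L.ψ_π, L.ψ_π] at h
  exact L.π_wordTail_mem_bdry_of_ne h hij

/-- A continuous function on the words that is constant on the fibres of `π` descends to `K`. -/
lemma exists_descend [CompactSpace K] [T2Space K] {F : (ℕ → Fin N) → ℝ} (hF : Continuous F)
    (h : ∀ ω τ, L.π ω = L.π τ → F ω = F τ) : ∃ g : C(K, ℝ), ∀ ω, g (L.π ω) = F ω := by
  have hq : IsQuotientMap L.π :=
    L.continuous_π.isClosedMap.isQuotientMap L.continuous_π L.surjective_π
  have h1 : ∀ ω, F (L.surjective_π (L.π ω)).choose = F ω := fun ω =>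
    h _ _ (L.surjective_π (L.π ω)).choose_spec
  refine ⟨⟨fun x => F (L.surjective_π x).choose, hq.continuous_iff.2 ?_⟩, h1⟩
  exact hF.congr fun ω => (h1 ω).symm

/-- A quantity attached to the cells that agrees on intersecting cells is constant. -/
lemma cell_const [CompactSpace K] [T2Space K] [ConnectedSpace K] {α : Type*} (c : Fin N → α)
    (hc : ∀ i j x y, L.ψ i x = L.ψ j y → c i = c j) (i j : Fin N) : c i = c j := by
  by_contra hij
  have hcl : ∀ s : Set (Fin N), IsClosed (⋃ k ∈ s, Set.range (L.ψ k)) := fun s =>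
    s.toFinite.isClosed_biUnion fun k _ => (isCompact_range (L.continuous_ψ k)).isClosed
  -- Cells with different values of c are disjoint, so this union and its complement are both finite
  -- unions of compact cells; connectedness finishes.
  have h1 : (⋃ k ∈ {k | c k = c i}, Set.range (L.ψ k))ᶜ
      = ⋃ k ∈ {k | c k ≠ c i}, Set.range (L.ψ k) := by
    ext x
    simp only [Set.mem_compl_iff, Set.mem_iUnion, Set.mem_range, not_exists, exists_prop,
      Set.mem_ofPred_eq, not_and]
    constructor
    · intro h
      obtain ⟨k, y, rfl⟩ := L.exists_ψ_eq x
      exact ⟨k, fun hk => h k hk y rfl, y, rfl⟩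
    · rintro ⟨k, hk, y, rfl⟩ l hl z hz
      exact hk ((hc k l y z hz.symm).trans hl)
  have hclopen : IsClopen (⋃ k ∈ {k | c k = c i}, Set.range (L.ψ k)) :=
    ⟨hcl _, by rw [← isClosed_compl_iff, h1]; exact hcl _⟩
  obtain ⟨x⟩ : Nonempty K := inferInstance
  rcases isClopen_iff.1 hclopen with h | h
  · have : L.ψ i x ∈ (∅ : Set K) := by
      rw [← h]; simp only [Set.mem_iUnion]; exact ⟨i, rfl, x, rfl⟩
    exact this
  · have : L.ψ j x ∈ (Set.univ : Set K)ᶜ := by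
      rw [← h, h1]; simp only [Set.mem_iUnion]; exact ⟨j, fun h => hij h.symm, x, rfl⟩
    exact this trivial

/-- A common point of two cells produces a point of V₀. With V₀ empty the cells would be disjoint,
and connectedness would leave only one letter. -/
lemma bdry_nonempty [CompactSpace K] [T2Space K] [ConnectedSpace K] : Nonempty L.bdry := by
  by_contra h
  have h01 : (⟨0, by have := L.two_le; omega⟩ : Fin N) = ⟨1, by have := L.two_le; omega⟩ :=
    L.cell_const id (fun i j x y hxy => by
      by_contra hij
      exact h ⟨⟨x, L.mem_bdry_of_ψ_eq hij hxy⟩⟩) _ _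
  simp at h01

/-- Cells of a high level are uniformly small. -/
lemma exists_level_lt [CompactSpace K] (u : C(K, ℝ)) {ε : ℝ} (hε : 0 < ε) :
    ∃ m : ℕ, ∀ ω τ : ℕ → Fin N, (∀ k < m, ω k = τ k) → |u (L.π ω) - u (L.π τ)| < ε := by
  let _ : MetricSpace (ℕ → Fin N) := PiNat.metricSpace
  have hc : UniformContinuous (fun ω => u (L.π ω)) :=
    CompactSpace.uniformContinuous_of_continuous (u.continuous.comp L.continuous_π)
  obtain ⟨δ, hδ, h⟩ := Metric.uniformContinuous_iff.1 hc ε hε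
  obtain ⟨m, hm⟩ := exists_pow_lt_of_lt_one hδ (by norm_num : (1 / 2 : ℝ) < 1)
  refine ⟨m, fun ω τ hωτ => ?_⟩
  have h1 : ω ∈ PiNat.cylinder τ m := PiNat.mem_cylinder_iff.2 hωτ
  have := h ((PiNat.mem_cylinder_iff_dist_le.1 h1).trans_lt hm)
  rwa [Real.dist_eq] at this

/-- Compatible continuous functions on the cells can be glued. -/
lemma exists_glue [CompactSpace K] [T2Space K] (g : Fin N → C(K, ℝ)) (u : K → ℝ)
    (h : ∀ i (q : L.bdry), g i q = u (L.ψ i q)) : ∃ G : C(K, ℝ), ∀ i x, G (L.ψ i x) = g i x := by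
  have hF : Continuous fun ω : ℕ → Fin N => g (ω 0) (L.π (wordTail ω)) := by
    have h2 : Continuous fun z : Fin N × K => g z.1 z.2 :=
      continuous_prod_of_discrete_left.2 fun i => (g i).continuous
    exact h2.comp ((continuous_apply 0).prodMk (L.continuous_π.comp continuous_wordTail))
  obtain ⟨G, hG⟩ := L.exists_descend hF fun ω τ hωτ => by
    by_cases h0 : ω 0 = τ 0
    · rw [h0, L.π_wordTail_eq hωτ h0]
    · have h1 := h (ω 0) ⟨_, L.π_wordTail_mem_bdry_of_ne hωτ h0⟩
      have h2 := h (τ 0) ⟨_, L.π_wordTail_mem_bdry_of_ne hωτ.symm (Ne.symm h0)⟩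
      simp only [L.ψ_π_wordTail] at h1 h2
      rw [h1, h2, hωτ]
  refine ⟨G, fun i x => ?_⟩
  obtain ⟨ω, rfl⟩ := L.surjective_π x
  rw [L.ψ_π, hG]
  rfl

end PCFStructure

namespace HarmonicStructure

variable {K : Type*} [TopologicalSpace K] {N : ℕ} {L : PCFStructure K N}

/-! ## One step of the harmonic extension -/

/-- Truncation decreases the energy. -/
lemma En_clamp_le (H : HarmonicStructure L) (m : ℕ) (u : K → ℝ) (a b : ℝ) :
    H.En m (fun x => max a (min b (u x))) (fun x => max a (min b (u x)))
      ≤ H.En m u (fun x => max a (min b (u x))) := by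
  rw [En_eq, En_eq]
  refine Finset.sum_le_sum fun e _ => mul_le_mul_of_nonneg_left ?_ (H.wt_nonneg m e)
  set s := u (src m e)
  set t := u (tgt m e)
  -- The cut-off is monotone and 1-Lipschitz, so its increments have the sign of those of u and are
  -- no larger. This bounds the energy by the mixed energy, which is more than contraction and is
  -- what `tendsto_form_trunc` needs.
  have key : ∀ s t : ℝ, t ≤ s → max a (min b t) ≤ max a (min b s) ∧
      max a (min b s) - max a (min b t) ≤ s - t := by
    intro s t hst
    refine ⟨max_le_max le_rfl (min_le_min le_rfl hst), ?_⟩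
    have h1 : max a (min b s) ≤ max a (min b t) + (s - t) := by
      rw [← max_add_add_right, ← min_add_add_right]
      exact max_le_max (by linarith) (min_le_min (by linarith) (by linarith))
    linarith
  rcases le_total t s with h | h
  · obtain ⟨h1, h2⟩ := key s t h
    exact mul_le_mul_of_nonneg_right h2 (by linarith)
  · obtain ⟨h1, h2⟩ := key t s h
    nlinarith

/-- With c the cut-off of u: 2E(c,c) ≤ 2E(u,c) ≤ E(u,u) + E(c,c). -/
lemma En_clamp_le_self (H : HarmonicStructure L) (m : ℕ) (u : K → ℝ) (a b : ℝ) :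
    H.En m (fun x => max a (min b (u x))) (fun x => max a (min b (u x))) ≤ H.En m u u := by
  have h1 := H.En_clamp_le m u a b
  have h2 := H.two_mul_abs_En_le m u (fun x => max a (min b (u x))) one_pos
  have h3 := le_abs_self (H.En m u (fun x => max a (min b (u x))))
  rw [inv_one, one_mul, one_mul] at h2
  linarith

lemma continuous_En (H : HarmonicStructure L) (m : ℕ) : Continuous fun u : K → ℝ => H.En m u u := by
  simp only [En_eq]
  fun_prop

/-- A minimal extension from `V₀` to `V₁` which satisfies the maximum principle. -/
lemma exists_step [Nonempty L.bdry] (H : HarmonicStructure L) (v : L.bdry → ℝ) :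
    ∃ u : K → ℝ, (∀ q : L.bdry, u q = v q) ∧ H.En 1 u u = L.energyZero H.D v v ∧
      ∀ x, ∃ p p', v p ≤ u x ∧ u x ≤ v p' := by
  classical
  obtain ⟨p, hp⟩ := Finite.exists_min v
  obtain ⟨p', hp'⟩ := Finite.exists_max v
  -- By Tychonoff this box of functions on all of K is compact, so a minimizer exists in it;
  -- truncation shows that it also minimizes among unrestricted extensions, and the box is the
  -- maximum principle.
  set T : Set (K → ℝ) := {u | (∀ x, u x ∈ Set.Icc (v p) (v p')) ∧ ∀ q : L.bdry, u q = v q}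
  have hT : IsCompact T := by
    have h1 : IsCompact (Set.univ.pi fun _ : K => Set.Icc (v p) (v p')) :=
      isCompact_univ_pi fun _ => isCompact_Icc
    have h2 : IsClosed {u : K → ℝ | ∀ q : L.bdry, u q = v q} := by
      rw [Set.ofPred_forall]
      exact isClosed_iInter fun q => isClosed_eq (continuous_apply _) continuous_const
    convert h1.inter_right h2 using 1
    ext u
    simp [T, Pi.le_def, forall_and]
  have clampT : ∀ u : K → ℝ, (∀ q : L.bdry, u q = v q) →
      (fun x => max (v p) (min (v p') (u x))) ∈ T := by
    intro u hu
    refine ⟨fun x => ⟨le_max_left _ _, max_le (hp p') (min_le_left _ _)⟩, fun q => ?_⟩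
    dsimp only
    rw [hu, min_eq_right (hp' q), max_eq_right (hp q)]
  have hTne : T.Nonempty :=
    -- The value 0 off V₀ is arbitrary; the cut-off moves it into the box.
    ⟨_, clampT (fun x => if h : x ∈ L.bdry then v ⟨x, h⟩ else 0) fun q => by simp⟩
  obtain ⟨u, hu, hmin⟩ := hT.exists_isMinOn hTne (H.continuous_En 1).continuousOn
  refine ⟨u, hu.2, le_antisymm ?_ ?_, fun x => ⟨p, p', (hu.1 x).1, (hu.1 x).2⟩⟩
  · refine (H.harmonic v).2 ?_
    rintro _ ⟨g, hg, rfl⟩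
    exact (hmin (clampT g hg)).trans (H.En_clamp_le_self 1 g _ _)
  · exact (H.harmonic v).1 ⟨u, hu.2, rfl⟩

/-- The oscillation on `V₀` is controlled by the energy. -/
lemma exists_sq_sub_le (H : HarmonicStructure L) :
    ∃ C : ℝ, 0 < C ∧ ∀ (v : L.bdry → ℝ) (p q : L.bdry),
      (v p - v q) ^ 2 ≤ C * L.energyZero H.D v v := by
  by_cases hne : Nonempty L.bdry
  swap
  · exact ⟨1, one_pos, fun v p => (hne ⟨p⟩).elim⟩
  obtain ⟨q0⟩ := hne
  have hnonneg : ∀ v : L.bdry → ℝ, 0 ≤ L.energyZero H.D v v := by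
    intro v
    rw [energyZero_eq]
    exact Finset.sum_nonneg fun p _ => Finset.sum_nonneg fun q _ =>
      mul_nonneg (H.cond_nonneg p q) (mul_self_nonneg _)
  have hcont : Continuous fun v : L.bdry → ℝ => L.energyZero H.D v v := by
    simp only [energyZero_eq]
    fun_prop
  -- Zero energy kills every edge term, hence Dv = 0 row by row.
  have hzero : ∀ v : L.bdry → ℝ, L.energyZero H.D v v = 0 → ∃ c, ∀ q, v q = c := by
    intro v hv
    rw [← H.ker]
    rw [energyZero_eq, Finset.sum_eq_zero_iff_of_nonneg (fun p _ => Finset.sum_nonneg fun q _ =>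
      mul_nonneg (H.cond_nonneg p q) (mul_self_nonneg _))] at hv
    ext p
    have h1 := hv p (Finset.mem_univ p)
    rw [Finset.sum_eq_zero_iff_of_nonneg (fun q _ =>
      mul_nonneg (H.cond_nonneg p q) (mul_self_nonneg _))] at h1
    have h2 : ∀ q, H.D p q * (v q - v p) = 0 := by
      intro q
      have h3 := h1 q (Finset.mem_univ q)
      unfold cond at h3
      split_ifs at h3 with hpq
      · simp [hpq]
      · rcases mul_eq_zero.1 h3 with h | h
        · have : H.D p q = 0 := by linarith
          simp [this]
        · have : v p - v q = 0 := mul_self_eq_zero.1 h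
          rw [show v q - v p = 0 by linarith, mul_zero]
    have h3 : ∑ q, H.D p q * v q - (∑ q, H.D p q) * v p = 0 := by
      rw [Finset.sum_mul, ← Finset.sum_sub_distrib]
      exact Finset.sum_eq_zero fun q _ => by rw [← mul_sub]; exact h2 q
    rw [H.sum_row_eq_zero, zero_mul, sub_zero] at h3
    simpa [Matrix.mulVec, dotProduct] using h3
  -- Fixing the value at q0 removes the constants, so the energy has a positive minimum on this
  -- compact set.
  set S : Set (L.bdry → ℝ) := Metric.sphere 0 1 ∩ {v | v q0 = 0}
  have hS : IsCompact S :=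
    (isCompact_sphere _ _).inter_right (isClosed_eq (continuous_apply _) continuous_const)
  obtain ⟨c, hc, hcS⟩ : ∃ c : ℝ, 0 < c ∧ ∀ v ∈ S, c ≤ L.energyZero H.D v v := by
    by_cases hSne : S.Nonempty
    · obtain ⟨v, hv, hmin⟩ := hS.exists_isMinOn hSne hcont.continuousOn
      refine ⟨_, lt_of_le_of_ne (hnonneg v) fun h => ?_, fun w hw => hmin hw⟩
      obtain ⟨c, hc⟩ := hzero v h.symm
      have h0 : v = 0 := by
        ext q
        rw [hc q, ← hc q0]
        exact hv.2
      have := hv.1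
      simp [h0] at this
    · exact ⟨1, one_pos, fun v hv => (hSne ⟨v, hv⟩).elim⟩
  have hmain : ∀ w : L.bdry → ℝ, w q0 = 0 → c * ‖w‖ ^ 2 ≤ L.energyZero H.D w w := by
    intro w hw
    by_cases hw0 : w = 0
    · rw [hw0, norm_zero]
      simpa using hnonneg 0
    have hn : 0 < ‖w‖ := norm_pos_iff.2 hw0
    have h1 : ‖w‖⁻¹ • w ∈ S :=
      ⟨by simp [norm_smul, hn.ne'], by simp [hw]⟩
    have h2 := hcS _ h1
    have h3 : L.energyZero H.D (‖w‖⁻¹ • w) (‖w‖⁻¹ • w)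
        = (‖w‖ ^ 2)⁻¹ * L.energyZero H.D w w := by
      simp only [energyZero_eq, Finset.mul_sum, Pi.smul_apply, smul_eq_mul]
      refine Finset.sum_congr rfl fun p _ => Finset.sum_congr rfl fun q _ => ?_
      field_simp
    rw [h3, ← div_eq_inv_mul, le_div_iff₀ (by positivity)] at h2
    exact h2
  -- Differences are at most twice the sup norm of v - v(q0); squaring gives the 4.
  refine ⟨4 / c, by positivity, fun v p q => ?_⟩
  have h1 := hmain (fun x => v x - v q0) (by simp)
  have h2 : L.energyZero H.D (fun x => v x - v q0) (fun x => v x - v q0)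
      = L.energyZero H.D v v := by
    simp only [energyZero_eq]
    simp
  rw [h2] at h1
  have h3 : ∀ x, |v x - v q0| ≤ ‖(fun x => v x - v q0)‖ := fun x => by
    simpa using norm_le_pi_norm (fun x => v x - v q0) x
  have h4 : |v p - v q| ≤ 2 * ‖(fun x => v x - v q0)‖ := by
    have : v p - v q = (v p - v q0) - (v q - v q0) := by ring
    rw [this]
    exact (abs_sub _ _).trans (by linarith [h3 p, h3 q])
  have h5 : (v p - v q) ^ 2 ≤ 4 * ‖(fun x => v x - v q0)‖ ^ 2 := by
    rw [← sq_abs]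
    nlinarith [abs_nonneg (v p - v q)]
  rw [div_mul_eq_mul_div, le_div_iff₀ hc]
  nlinarith

end HarmonicStructure

namespace HarmonicStructure

variable {K : Type*} [TopologicalSpace K] {N : ℕ} {L : PCFStructure K N}

/-! ## The harmonic extension -/

section Extension

lemma energyZero_nonneg (H : HarmonicStructure L) (v : L.bdry → ℝ) : 0 ≤ L.energyZero H.D v v := by
  rw [energyZero_eq]
  exact Finset.sum_nonneg fun p _ => Finset.sum_nonneg fun q _ =>
    mul_nonneg (H.cond_nonneg p q) (mul_self_nonneg _)

lemma exists_ratio (H : HarmonicStructure L) : ∃ ρ : ℝ, 0 < ρ ∧ ρ < 1 ∧ ∀ i, H.r i ≤ ρ := by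
  have : Nonempty (Fin N) := ⟨⟨0, by have := L.two_le; omega⟩⟩
  obtain ⟨i, hi⟩ := Finite.exists_max H.r
  exact ⟨H.r i, H.r_pos i, H.r_lt_one i, hi⟩

/-! ### Iterated minimal extension along infinite words. -/

variable [Nonempty L.bdry] (H : HarmonicStructure L)

/-- A chosen minimal extension to `V₁`. -/
def step (v : L.bdry → ℝ) : K → ℝ := (H.exists_step v).choose

lemma step_bdry (v : L.bdry → ℝ) (q : L.bdry) : H.step v q = v q :=
  (H.exists_step v).choose_spec.1 q

lemma step_bounds (v : L.bdry → ℝ) (x : K) : ∃ p p', v p ≤ H.step v x ∧ H.step v x ≤ v p' :=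
  (H.exists_step v).choose_spec.2.2 x

/-- The boundary values on the cell `K_i` of the minimal extension. -/
def sub (v : L.bdry → ℝ) (i : Fin N) : L.bdry → ℝ := fun q => H.step v (L.ψ i q)

lemma sum_energyZero_sub (v : L.bdry → ℝ) :
    ∑ i, (H.r i)⁻¹ * L.energyZero H.D (H.sub v i) (H.sub v i) = L.energyZero H.D v v := by
  rw [← (H.exists_step v).choose_spec.2.1]
  change _ = H.En 1 (H.step v) (H.step v)
  rw [En_succ]
  simp only [En_zero]
  rfl

lemma energyZero_sub_le (v : L.bdry → ℝ) (i : Fin N) :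
    L.energyZero H.D (H.sub v i) (H.sub v i) ≤ H.r i * L.energyZero H.D v v := by
  rw [← H.sum_energyZero_sub v, ← inv_mul_le_iff₀ (H.r_pos i)]
  exact Finset.single_le_sum (f := fun j => (H.r j)⁻¹ * L.energyZero H.D (H.sub v j) (H.sub v j))
    (fun j _ => mul_nonneg (inv_nonneg.2 (H.r_pos j).le) (H.energyZero_nonneg _))
    (Finset.mem_univ i)

/-- The boundary values on the cells of increasing level along a word. -/
def iter (v : L.bdry → ℝ) (ω : ℕ → Fin N) : ℕ → L.bdry → ℝ
  | 0 => v
  | n + 1 => H.sub (iter v ω n) (ω n)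

/-- The recursion of `iter` consumes letters at the far end; removing the first letter instead is
what matches pulling back by ψ. -/
lemma iter_succ' (v : L.bdry → ℝ) (ω : ℕ → Fin N) (n : ℕ) :
    H.iter v ω (n + 1) = H.iter (H.sub v (ω 0)) (wordTail ω) n := by
  induction n with
  | zero => rfl
  | succ n ih => rw [iter, ih]; rfl

lemma iter_congr (v : L.bdry → ℝ) {ω τ : ℕ → Fin N} {n : ℕ} (h : ∀ k < n, ω k = τ k) :
    H.iter v ω n = H.iter v τ n := by
  induction n with
  | zero => rfl
  | succ n ih => rw [iter, iter, ih fun k hk => h k (by omega), h n (by omega)]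

lemma iter_bounds (v : L.bdry → ℝ) (ω : ℕ → Fin N) (n k : ℕ) (q : L.bdry) :
    ∃ p p', H.iter v ω n p ≤ H.iter v ω (n + k) q ∧ H.iter v ω (n + k) q ≤ H.iter v ω n p' := by
  induction k generalizing q with
  | zero => exact ⟨q, q, le_rfl, le_rfl⟩
  | succ k ih =>
    obtain ⟨p, p', h, h'⟩ := H.step_bounds (H.iter v ω (n + k)) (L.ψ (ω (n + k)) q)
    obtain ⟨a, _, ha, _⟩ := ih p
    obtain ⟨_, b, _, hb⟩ := ih p'
    exact ⟨a, b, ha.trans h, h'.trans hb⟩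

/-- The oscillation along a word tends to zero uniformly. -/
lemma exists_osc_bound (v : L.bdry → ℝ) :
    ∃ δ : ℕ → ℝ, Tendsto δ atTop (𝓝 0) ∧ ∀ ω n k q q',
      |H.iter v ω (n + k) q - H.iter v ω n q'| ≤ δ n := by
  obtain ⟨C, hC, hosc⟩ := H.exists_sq_sub_le
  obtain ⟨ρ, hρ0, hρ1, hρ⟩ := H.exists_ratio
  -- Regularity enters here: each letter multiplies the energy by at most ρ < 1. The oscillation on
  -- a cell is bounded by the square root of its energy, and deeper values stay between those on the
  -- cell by the maximum principle.
  have hen : ∀ ω n, L.energyZero H.D (H.iter v ω n) (H.iter v ω n)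
      ≤ ρ ^ n * L.energyZero H.D v v := by
    intro ω n
    induction n with
    | zero => simp [iter]
    | succ n ih =>
      refine (H.energyZero_sub_le _ _).trans ?_
      rw [pow_succ', mul_assoc]
      exact mul_le_mul (hρ _) ih (H.energyZero_nonneg _) hρ0.le
  refine ⟨fun n => √(C * (ρ ^ n * L.energyZero H.D v v)), ?_, ?_⟩
  · have h := (((tendsto_pow_atTop_nhds_zero_of_lt_one hρ0.le hρ1).mul_const
      (L.energyZero H.D v v)).const_mul C).sqrt
    simpa using h
  · intro ω n k q q'
    have h : ∀ a b, |H.iter v ω n a - H.iter v ω n b| ≤ √(C * (ρ ^ n * L.energyZero H.D v v)) :=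
      fun a b => Real.abs_le_sqrt ((hosc _ a b).trans (mul_le_mul_of_nonneg_left (hen ω n) hC.le))
    obtain ⟨p, p', hp, hp'⟩ := H.iter_bounds v ω n k q
    rw [abs_le]
    have h1 := (abs_le.1 (h p q')).1
    have h2 := (abs_le.1 (h p' q')).2
    constructor <;> linarith

lemma exists_tendsto_iter (v : L.bdry → ℝ) (ω : ℕ → Fin N) :
    ∃ y, ∀ q, Tendsto (fun n => H.iter v ω n q) atTop (𝓝 y) := by
  obtain ⟨δ, hδ, h⟩ := H.exists_osc_bound v
  obtain ⟨q0⟩ : Nonempty L.bdry := inferInstance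
  have hc : CauchySeq fun n => H.iter v ω n q0 := by
    refine Metric.cauchySeq_iff'.2 fun ε hε => ?_
    obtain ⟨n, hn⟩ := (hδ.eventually_lt_const hε).exists
    refine ⟨n, fun k hk => ?_⟩
    obtain ⟨k, rfl⟩ := Nat.exists_eq_add_of_le hk
    exact (h ω n k q0 q0).trans_lt hn
  obtain ⟨y, hy⟩ := cauchySeq_tendsto_of_complete hc
  refine ⟨y, fun q => ?_⟩
  have h0 : Tendsto (fun n => H.iter v ω n q - H.iter v ω n q0) atTop (𝓝 0) :=
    squeeze_zero_norm (fun n => h ω n 0 q q0) hδ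
  simpa using h0.add hy

/-- The harmonic extension, read on words. -/
def wordExt (v : L.bdry → ℝ) (ω : ℕ → Fin N) : ℝ := (H.exists_tendsto_iter v ω).choose

lemma tendsto_iter (v : L.bdry → ℝ) (ω : ℕ → Fin N) (q : L.bdry) :
    Tendsto (fun n => H.iter v ω n q) atTop (𝓝 (H.wordExt v ω)) :=
  (H.exists_tendsto_iter v ω).choose_spec q

lemma wordExt_eq (v : L.bdry → ℝ) (ω : ℕ → Fin N) :
    H.wordExt v ω = H.wordExt (H.sub v (ω 0)) (wordTail ω) := by
  obtain ⟨q⟩ : Nonempty L.bdry := inferInstance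
  refine tendsto_nhds_unique ((H.tendsto_iter v ω q).comp (tendsto_add_atTop_nat 1)) ?_
  refine (H.tendsto_iter (H.sub v (ω 0)) (wordTail ω) q).congr fun n => ?_
  exact (congrFun (H.iter_succ' v ω n) q).symm

/-- A uniform limit of functions depending on finitely many letters. -/
lemma continuous_wordExt (v : L.bdry → ℝ) : Continuous (H.wordExt v) := by
  obtain ⟨δ, hδ, h⟩ := H.exists_osc_bound v
  obtain ⟨q⟩ : Nonempty L.bdry := inferInstance
  have hlim : ∀ ω n, |H.wordExt v ω - H.iter v ω n q| ≤ δ n := by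
    intro ω n
    have h1 : Tendsto (fun k => |H.iter v ω (k + n) q - H.iter v ω n q|) atTop
        (𝓝 |H.wordExt v ω - H.iter v ω n q|) :=
      (((H.tendsto_iter v ω q).comp (tendsto_add_atTop_nat n)).sub_const _).abs
    exact le_of_tendsto' h1 fun k => by rw [add_comm]; exact h ω n k q q
  refine continuous_iff_continuousAt.2 fun ω => Metric.continuousAt_iff'.2 fun ε hε => ?_
  obtain ⟨n, hn⟩ := (hδ.eventually_lt_const (half_pos hε)).exists
  filter_upwards [(PiNat.isOpen_cylinder (fun _ => Fin N) ω n).mem_nhds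
    (PiNat.self_mem_cylinder ω n)] with τ hτ
  have h1 := H.iter_congr v (PiNat.mem_cylinder_iff.1 hτ)
  have h2 := hlim ω n
  have h3 := hlim τ n
  rw [h1] at h3
  rw [Real.dist_eq]
  have : H.wordExt v τ - H.wordExt v ω
      = (H.wordExt v τ - H.iter v ω n q) - (H.wordExt v ω - H.iter v ω n q) := by ring
  rw [this]
  exact (abs_sub _ _).trans_lt (by linarith)

/-- All tails of ω code points of V₀, so at each level some vertex of the cell carries exactly the
prescribed value; the shrinking oscillation does the rest. -/
lemma wordExt_of_bdry (v : L.bdry → ℝ) {ω : ℕ → Fin N} (hω : L.π ω ∈ L.bdry) :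
    H.wordExt v ω = v ⟨L.π ω, hω⟩ := by
  obtain ⟨δ, hδ, hd⟩ := H.exists_osc_bound v
  have h : ∀ n, ∃ q, H.iter v ω n q = v ⟨L.π ω, hω⟩ := by
    intro n
    suffices ∀ (v : L.bdry → ℝ) (ω : ℕ → Fin N) (hω : L.π ω ∈ L.bdry),
        ∃ q, H.iter v ω n q = v ⟨L.π ω, hω⟩ from this v ω hω
    induction n with
    | zero => exact fun v ω hω => ⟨_, rfl⟩
    | succ n ih =>
      intro v ω hω
      obtain ⟨q, hq⟩ := ih (H.sub v (ω 0)) (wordTail ω) (L.π_wordTail_mem_bdry hω)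
      refine ⟨q, ?_⟩
      rw [iter_succ', hq, sub]
      simp only [L.ψ_π_wordTail]
      exact H.step_bdry v ⟨_, hω⟩
  obtain ⟨q0⟩ : Nonempty L.bdry := inferInstance
  refine tendsto_nhds_unique (H.tendsto_iter v ω q0) ?_
  rw [tendsto_iff_dist_tendsto_zero]
  refine squeeze_zero (fun _ => dist_nonneg) (fun n => ?_) hδ
  obtain ⟨q, hq⟩ := h n
  rw [← hq]
  exact hd ω n 0 q0 q

/-- Induction on an index where the words differ: common first letters are stripped, and once the
first letters differ both tails code boundary points, so both sides are the value of `step` at the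
common point. -/
lemma wordExt_congr (v : L.bdry → ℝ) (ω τ : ℕ → Fin N) (h : L.π ω = L.π τ) :
    H.wordExt v ω = H.wordExt v τ := by
  by_cases hne : ω = τ
  · rw [hne]
  have key : ∀ n (v : L.bdry → ℝ) (ω τ : ℕ → Fin N), L.π ω = L.π τ → ω n ≠ τ n →
      H.wordExt v ω = H.wordExt v τ := by
    intro n
    induction n with
    | zero =>
      intro v ω τ h h0
      rw [H.wordExt_eq v ω, H.wordExt_eq v τ,
        H.wordExt_of_bdry _ (L.π_wordTail_mem_bdry_of_ne h h0),
        H.wordExt_of_bdry _ (L.π_wordTail_mem_bdry_of_ne h.symm (Ne.symm h0))]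
      simp only [sub, L.ψ_π_wordTail]
      rw [h]
    | succ n ih =>
      intro v ω τ h hn
      by_cases h0 : ω 0 = τ 0
      · rw [H.wordExt_eq v ω, H.wordExt_eq v τ, h0]
        exact ih _ _ _ (L.π_wordTail_eq h h0) hn
      · rw [H.wordExt_eq v ω, H.wordExt_eq v τ,
          H.wordExt_of_bdry _ (L.π_wordTail_mem_bdry_of_ne h h0),
          H.wordExt_of_bdry _ (L.π_wordTail_mem_bdry_of_ne h.symm (Ne.symm h0))]
        simp only [sub, L.ψ_π_wordTail]
        rw [h]
  obtain ⟨n, hn⟩ := Function.ne_iff.1 hne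
  exact key n v ω τ h hn

/-! ### Descent of the extension from words to K. -/

variable [CompactSpace K] [T2Space K]

/-- A continuous extension of minimal energy, constructed along words. -/
def ext (v : L.bdry → ℝ) : C(K, ℝ) :=
  (L.exists_descend (H.continuous_wordExt v) (H.wordExt_congr v)).choose

lemma ext_π (v : L.bdry → ℝ) (ω : ℕ → Fin N) : H.ext v (L.π ω) = H.wordExt v ω :=
  (L.exists_descend (H.continuous_wordExt v) (H.wordExt_congr v)).choose_spec ω

lemma ext_bdry (v : L.bdry → ℝ) (q : L.bdry) : H.ext v q = v q := by
  obtain ⟨q, hq⟩ := q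
  obtain ⟨ω, rfl⟩ := L.surjective_π q
  rw [ext_π, H.wordExt_of_bdry v hq]

lemma pull_ext (v : L.bdry → ℝ) (i : Fin N) : pull L i (H.ext v) = H.ext (H.sub v i) := by
  ext x
  obtain ⟨ω, rfl⟩ := L.surjective_π x
  rw [pull_apply, L.ψ_π, ext_π, ext_π, wordExt_eq]
  rfl

lemma En_ext (v : L.bdry → ℝ) (m : ℕ) : H.En m (H.ext v) (H.ext v) = L.energyZero H.D v v := by
  induction m generalizing v with
  | zero => rw [En_zero]; simp only [ext_bdry]
  | succ m ih =>
    rw [En_succ, ← H.sum_energyZero_sub v]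
    refine Finset.sum_congr rfl fun i _ => ?_
    rw [← coe_pull, pull_ext, ih]

lemma ext_mem_Icc {v : L.bdry → ℝ} {a b : ℝ} (h : ∀ q, v q ∈ Set.Icc a b) (x : K) :
    H.ext v x ∈ Set.Icc a b := by
  obtain ⟨ω, rfl⟩ := L.surjective_π x
  obtain ⟨q⟩ : Nonempty L.bdry := inferInstance
  rw [ext_π]
  refine isClosed_Icc.mem_of_tendsto (H.tendsto_iter v ω q) (Eventually.of_forall fun n => ?_)
  obtain ⟨p, p', hp, hp'⟩ := H.iter_bounds v ω 0 n q
  rw [zero_add] at hp hp'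
  exact ⟨(h p).1.trans hp, hp'.trans (h p').2⟩

end Extension

/-! ## Harmonic functions -/

/-- The harmonic functions: those whose energies of all levels are equal. -/
def harm (H : HarmonicStructure L) : Submodule ℝ C(K, ℝ) where
  carrier := {h | ∀ m, H.En m h h = H.En 0 h h}
  zero_mem' := fun m => by simp [En_eq]
  add_mem' := by
    intro u v hu hv m
    -- The energies of u + v and u - v can only grow with the level, while by the parallelogram law
    -- their sum stays constant; so neither grows.
    have h1 := H.En_mono ((u : K → ℝ) + v) (Nat.zero_le m)
    have h2 := H.En_mono ((u : K → ℝ) - v) (Nat.zero_le m)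
    have h3 := hu m
    have h4 := hv m
    simp only [ContinuousMap.coe_add, En_add_left, En_add_right, En_sub_left, En_sub_right] at *
    linarith
  smul_mem' := by
    intro c u hu m
    rw [ContinuousMap.coe_smul, En_smul_left, En_smul_right, En_smul_left, En_smul_right, hu m]

lemma mem_harm (H : HarmonicStructure L) {h : C(K, ℝ)} :
    h ∈ H.harm ↔ ∀ m, H.En m h h = H.En 0 h h := Iff.rfl

/-- A harmonic function is orthogonal to the increments of the energy. -/
lemma En_eq_zero_level (H : HarmonicStructure L) {h : C(K, ℝ)} (hh : h ∈ H.harm) (m : ℕ)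
    (v : K → ℝ) : H.En m h v = H.En 0 h v := by
  have key : ∀ t : ℝ, 0 ≤ 2 * t * (H.En m h v - H.En 0 h v)
      + t ^ 2 * (H.En m v v - H.En 0 v v) := by
    intro t
    have h1 := H.En_mono ((h : K → ℝ) + t • v) (Nat.zero_le m)
    simp only [En_add_left, En_add_right, En_smul_left, En_smul_right, H.En_comm _ v h, hh m] at h1
    linarith
  set a := H.En m h v - H.En 0 h v with ha
  set b := H.En m v v - H.En 0 v v
  have hb : 0 ≤ b := sub_nonneg.2 (H.En_mono v (Nat.zero_le m))
  suffices a = 0 by linarith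
  by_contra hne
  -- A nonnegative quadratic in t without constant term has no linear term. The 1 in b + 1 covers b
  -- = 0.
  have h1 := key (-a / (b + 1))
  have h2 : 2 * (-a / (b + 1)) * a + (-a / (b + 1)) ^ 2 * b
      = -(a ^ 2 * (b + 2) / (b + 1) ^ 2) := by
    field_simp
    ring
  rw [h2] at h1
  have : 0 < a ^ 2 * (b + 2) / (b + 1) ^ 2 := by positivity
  linarith

lemma harm_le_dom (H : HarmonicStructure L) {h : C(K, ℝ)} (hh : h ∈ H.harm) :
    h ∈ H.dirichletForm.dom :=
  (H.mem_dom_iff h).2 ⟨H.En 0 h h, fun m => (hh m).le⟩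

/-! ### Uniqueness of harmonic functions and their identification with energy minimizers. -/

section Connected

lemma form_eq_of_harm (H : HarmonicStructure L) {h : C(K, ℝ)} (hh : h ∈ H.harm) :
    H.dirichletForm.form h h = H.En 0 h h :=
  H.form_eq_of_eventually (Eventually.of_forall hh)

variable [CompactSpace K] [T2Space K] [ConnectedSpace K]

/-- A continuous function whose energies all vanish is constant. -/
lemma eq_const_of_En_eq_zero (H : HarmonicStructure L) {f : C(K, ℝ)}
    (hf : ∀ m, H.En m f f = 0) {q : L.bdry} {c : ℝ} (hq : f q = c) (x : K) : f x = c := by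
  have hpull : ∀ f : C(K, ℝ), (∀ m, H.En m f f = 0) → ∀ i m,
      H.En m (pull L i f) (pull L i f) = 0 := by
    intro f hf i m
    refine le_antisymm ?_ (H.En_nonneg _ _)
    have := H.En_pull_le m i f
    rwa [hf, mul_zero] at this
  have hV : ∀ f : C(K, ℝ), (∀ m, H.En m f f = 0) → ∀ p q : L.bdry, f p = f q := by
    intro f hf p q
    obtain ⟨C, hC, h⟩ := H.exists_sq_sub_le
    have h1 := h (fun q => f q) p q
    rw [← En_zero, hf 0, mul_zero] at h1
    have := pow_eq_zero_iff (two_ne_zero) |>.1 (le_antisymm h1 (sq_nonneg _))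
    linarith
  have hstep : ∀ f : C(K, ℝ), (∀ m, H.En m f f = 0) → ∀ (i : Fin N) (p q : L.bdry),
      f (L.ψ i p) = f q := by
    intro f hf i p q
    -- On each ψ_i(V₀) the function is constant, and intersecting cells meet in points of both
    -- images, so connectedness makes the constants equal.
    have hc := L.cell_const (fun i => f (L.ψ i q)) (fun i j x y hxy => by
      by_cases hij : i = j
      · rw [hij]
      have hx := L.mem_bdry_of_ψ_eq hij hxy
      have hy := L.mem_bdry_of_ψ_eq (Ne.symm hij) hxy.symm
      have h1 := hV _ (hpull f hf i) q ⟨x, hx⟩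
      have h2 := hV _ (hpull f hf j) q ⟨y, hy⟩
      simp only [pull_apply] at h1 h2
      rw [h1, h2, hxy])
    obtain ⟨j, p', hj⟩ := L.exists_bdry_ψ_eq q
    have h1 := hV _ (hpull f hf i) p q
    have h2 := hV _ (hpull f hf j) p' q
    simp only [pull_apply] at h1 h2
    exact h1.trans ((hc i j).trans (h2.symm.trans (congrArg f hj)))
  -- Words that follow ω for n letters and then continue with a post-critical word code points of
  -- V_n and converge to ω.
  have hwords : ∀ (n : ℕ) (ω τ : ℕ → Fin N), τ ∈ L.postCriticalSet → ∀ f : C(K, ℝ),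
      (∀ m, H.En m f f = 0) → f q = c → f (L.π fun k => if k < n then ω k else τ (k - n)) = c := by
    intro n
    induction n with
    | zero =>
      intro ω τ hτ f hf hq
      rw [← hq]
      exact hV f hf ⟨_, ⟨τ, hτ, by simp⟩⟩ q
    | succ n ih =>
      intro ω τ hτ f hf hq
      have h1 := ih (wordTail ω) τ hτ (pull L (ω 0) f) (hpull f hf _)
        ((hstep f hf (ω 0) q q).trans hq)
      rw [pull_apply, L.ψ_π] at h1
      convert h1 using 3
      ext k
      cases k with
      | zero => simp [wordCons]
      | succ k => simp [wordCons, wordTail]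
  obtain ⟨ω, rfl⟩ := L.surjective_π x
  obtain ⟨⟨_, τ, hτ, rfl⟩⟩ := L.bdry_nonempty
  have hlim : Tendsto (fun n k => if k < n then ω k else τ (k - n)) atTop (𝓝 ω) := by
    refine tendsto_pi_nhds.2 fun k => ?_
    refine tendsto_const_nhds.congr' ?_
    filter_upwards [eventually_gt_atTop k] with n hn
    rw [if_pos hn]
  have h1 := ((f.continuous.comp L.continuous_π).tendsto ω).comp hlim
  refine tendsto_nhds_unique h1 (tendsto_const_nhds.congr fun n => ?_)
  exact (hwords n ω τ hτ f hf hq).symm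

lemma harm_eq_of_bdry_eq (H : HarmonicStructure L) {f g : C(K, ℝ)} (hf : f ∈ H.harm)
    (hg : g ∈ H.harm) (h : ∀ q : L.bdry, f q = g q) : f = g := by
  have h0 : H.En 0 (f - g : C(K, ℝ)) (f - g : C(K, ℝ)) = 0 := by
    rw [En_zero, energyZero_eq]
    simp [h]
  obtain ⟨q⟩ := L.bdry_nonempty
  ext x
  have := H.eq_const_of_En_eq_zero (f := f - g) (fun m => by rw [H.harm.sub_mem hf hg m, h0])
    (q := q) (c := 0) (by simp [h]) x
  simpa [sub_eq_zero] using this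

lemma exists_harm (H : HarmonicStructure L) (v : L.bdry → ℝ) :
    ∃ h ∈ H.harm, (∀ q : L.bdry, h q = v q) ∧
      ∀ a b, (∀ q, v q ∈ Set.Icc a b) → ∀ x, h x ∈ Set.Icc a b :=
  have := L.bdry_nonempty
  ⟨H.ext v, fun m => by rw [En_ext, En_ext], H.ext_bdry v, fun _ _ => H.ext_mem_Icc⟩

omit [CompactSpace K] [T2Space K] [ConnectedSpace K] in
lemma isHarmonicExtension_of_harm (H : HarmonicStructure L) {h : C(K, ℝ)} (hh : h ∈ H.harm)
    {v : L.bdry → ℝ} (hv : ∀ q : L.bdry, h q = v q) : H.IsHarmonicExtension v h := by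
  refine ⟨H.harm_le_dom hh, hv, fun g hg hgv => ?_⟩
  rw [H.form_eq_of_harm hh]
  refine le_trans (le_of_eq ?_) (H.En_le_form hg 0)
  rw [En_zero, En_zero]
  simp only [hv, hgv]

/-- Comparison with the constructed extension g closes the chain E⁽ᵐ⁾(h) ≤ E(h) ≤ E(g) = E⁽⁰⁾(g) =
E⁽⁰⁾(h). -/
lemma IsHarmonicExtension.mem_harm {H : HarmonicStructure L} {v : L.bdry → ℝ} {h : C(K, ℝ)}
    (hh : H.IsHarmonicExtension v h) : h ∈ H.harm := by
  obtain ⟨g, hg, hgv, -⟩ := H.exists_harm v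
  intro m
  refine le_antisymm ?_ (H.En_mono h (Nat.zero_le m))
  refine (H.En_le_form hh.mem_dom m).trans
    ((hh.minimal g (H.harm_le_dom hg) hgv).trans (le_of_eq ?_))
  rw [H.form_eq_of_harm hg, En_zero, En_zero]
  simp only [hgv, hh.bdry_eq]

lemma isHarmonicExtension_harmonicExtension (H : HarmonicStructure L) (v : L.bdry → ℝ) :
    H.IsHarmonicExtension v (H.harmonicExtension v) := by
  obtain ⟨g, hg, hgv, -⟩ := H.exists_harm v
  have h : ∃ f, H.IsHarmonicExtension v f := ⟨g, H.isHarmonicExtension_of_harm hg hgv⟩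
  rw [harmonicExtension, dif_pos h]
  exact h.choose_spec

lemma harmonicBasis_mem_harm (H : HarmonicStructure L) (q : L.bdry) : H.harmonicBasis q ∈ H.harm :=
  (H.isHarmonicExtension_harmonicExtension _).mem_harm

lemma eq_sum_harmonicBasis (H : HarmonicStructure L) {h : C(K, ℝ)} (hh : h ∈ H.harm) :
    h = ∑ q : L.bdry, h q • H.harmonicBasis q := by
  classical
  refine H.harm_eq_of_bdry_eq hh (H.harm.sum_mem fun q _ =>
    H.harm.smul_mem _ (H.harmonicBasis_mem_harm q)) fun p => ?_
  rw [ContinuousMap.sum_apply, Finset.sum_eq_single p]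
  · simp [harmonicBasis, (H.isHarmonicExtension_harmonicExtension _).bdry_eq p]
  · intro q _ hqp
    simp [harmonicBasis, (H.isHarmonicExtension_harmonicExtension _).bdry_eq p,
      Pi.single_eq_of_ne (Ne.symm hqp)]
  · simp

end Connected

end HarmonicStructure

namespace HarmonicStructure

variable {K : Type*} [TopologicalSpace K] {N : ℕ} {L : PCFStructure K N}

/-! ## Piecewise harmonic functions -/

/-- The `m`-piecewise harmonic functions. -/
def pharm (H : HarmonicStructure L) : ℕ → Submodule ℝ C(K, ℝ)
  | 0 => H.harm
  | m + 1 => ⨅ i, (pharm H m).comap (pull L i)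

lemma mem_pharm_succ (H : HarmonicStructure L) {m : ℕ} {f : C(K, ℝ)} :
    f ∈ H.pharm (m + 1) ↔ ∀ i, pull L i f ∈ H.pharm m := by
  simp [pharm, Submodule.mem_iInf]

/-- Harmonicity on each cell of level m makes f orthogonal to every later energy increment. The
other argument is arbitrary, so the pairing with f sees only finitely many of its values. -/
lemma En_pharm (H : HarmonicStructure L) {m : ℕ} {f : C(K, ℝ)} (hf : f ∈ H.pharm m) {k : ℕ}
    (hk : m ≤ k) (v : K → ℝ) : H.En k f v = H.En m f v := by
  induction m generalizing f k v with
  | zero => exact H.En_eq_zero_level hf k v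
  | succ m ih =>
    obtain ⟨k, rfl⟩ : ∃ l, k = l + 1 := ⟨k - 1, by omega⟩
    rw [En_succ, En_succ]
    refine Finset.sum_congr rfl fun i _ => ?_
    rw [← coe_pull, ih (H.mem_pharm_succ.1 hf i) (by omega)]

lemma pharm_le_dom (H : HarmonicStructure L) {m : ℕ} {f : C(K, ℝ)} (hf : f ∈ H.pharm m) :
    f ∈ H.dirichletForm.dom := by
  refine (H.mem_dom_iff f).2 ⟨H.En m f f, fun k => ?_⟩
  rcases le_total m k with h | h
  · exact (H.En_pharm hf h f).le
  · exact H.En_mono f h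

lemma form_pharm (H : HarmonicStructure L) {m : ℕ} {f : C(K, ℝ)} (hf : f ∈ H.pharm m)
    (v : C(K, ℝ)) : H.dirichletForm.form f v = H.En m f v :=
  H.form_eq_of_eventually ((eventually_ge_atTop m).mono fun _ hk => H.En_pharm hf hk v)

variable [CompactSpace K] [T2Space K] [ConnectedSpace K]

/-- A function is determined by its pull-backs to the cells, and a harmonic one by its values on V₀.
-/
instance finite_pharm (H : HarmonicStructure L) (m : ℕ) : Module.Finite ℝ (H.pharm m) := by
  induction m with
  | zero =>
    let φ : H.harm →ₗ[ℝ] (L.bdry → ℝ) :=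
      { toFun := fun h q => (h : C(K, ℝ)) q
        map_add' := fun _ _ => rfl
        map_smul' := fun _ _ => rfl }
    exact Module.Finite.of_injective φ fun f g h =>
      Subtype.ext (H.harm_eq_of_bdry_eq f.2 g.2 fun q => congrFun h q)
  | succ m ih =>
    let φ : H.pharm (m + 1) →ₗ[ℝ] (Fin N → H.pharm m) :=
      { toFun := fun f i => ⟨pull L i f, H.mem_pharm_succ.1 f.2 i⟩
        map_add' := fun _ _ => rfl
        map_smul' := fun _ _ => rfl }
    refine Module.Finite.of_injective φ fun f g h => Subtype.ext (ContinuousMap.ext fun x => ?_)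
    obtain ⟨i, y, rfl⟩ := L.exists_ψ_eq x
    have h1 := congrArg Subtype.val (congrFun h i)
    exact congrArg (fun F : C(K, ℝ) => F y) h1

/-- Piecewise harmonic interpolation. -/
lemma exists_interp (H : HarmonicStructure L) (m : ℕ) (u : K → ℝ) :
    ∃ g ∈ H.pharm m, (∀ q : L.bdry, g q = u q) ∧ (∀ v, H.En m g v = H.En m u v) ∧
      ∀ ε, (∀ ω τ : ℕ → Fin N, (∀ k < m, ω k = τ k) → |u (L.π ω) - u (L.π τ)| ≤ ε) →
        ∀ x, |g x - u x| ≤ ε := by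
  induction m generalizing u with
  | zero =>
    obtain ⟨h, hh, hv, hb⟩ := H.exists_harm fun q => u q
    refine ⟨h, hh, hv, fun v => ?_, fun ε hε x => ?_⟩
    · rw [En_zero, En_zero]
      simp only [hv]
    -- At level 0 the hypothesis bounds the oscillation of u on all of K, and the maximum principle
    -- passes it to the interpolant.
    · have h1 := hb (u x - ε) (u x + ε) (fun q => ?_) x
      · rw [abs_le]
        constructor <;> linarith [h1.1, h1.2]
      · obtain ⟨ω, hω⟩ := L.surjective_π (q : K)
        obtain ⟨τ, rfl⟩ := L.surjective_π x
        have h2 := abs_le.1 (hε ω τ (by simp))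
        rw [hω] at h2
        constructor <;> linarith [h2.1, h2.2]
  | succ m ih =>
    choose g hg hgb hgE hgo using fun i => ih (u ∘ L.ψ i)
    obtain ⟨G, hG⟩ := L.exists_glue g u fun i q => hgb i q
    have hpull : ∀ i, pull L i G = g i := fun i => ContinuousMap.ext (hG i)
    refine ⟨G, H.mem_pharm_succ.2 fun i => by rw [hpull]; exact hg i, fun q => ?_, fun v => ?_,
      fun ε hε x => ?_⟩
    · obtain ⟨i, p, hp⟩ := L.exists_bdry_ψ_eq q
      rw [← hp, hG, hgb]
      rfl
    · rw [En_succ, En_succ]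
      refine Finset.sum_congr rfl fun i _ => ?_
      rw [← coe_pull, hpull, hgE]
    · obtain ⟨i, y, rfl⟩ := L.exists_ψ_eq x
      rw [hG]
      refine hgo i ε (fun ω τ hωτ => ?_) y
      simp only [Function.comp_apply, L.ψ_π]
      refine hε _ _ fun k hk => ?_
      cases k with
      | zero => rfl
      | succ k => exact hωτ k (by omega)

/-- The domain is uniformly dense in `C(K)`. -/
lemma exists_mem_dom_near (H : HarmonicStructure L) (u : C(K, ℝ)) {ε : ℝ} (hε : 0 < ε) :
    ∃ g ∈ H.dirichletForm.dom, ∀ x, |g x - u x| ≤ ε := by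
  obtain ⟨m, hm⟩ := L.exists_level_lt u hε
  obtain ⟨g, hg, -, -, h⟩ := H.exists_interp m u
  exact ⟨g, H.pharm_le_dom hg, h ε fun ω τ hωτ => (hm ω τ hωτ).le⟩

/-- Piecewise harmonic functions approximate in energy. -/
lemma exists_pharm_approx (H : HarmonicStructure L) {f : C(K, ℝ)}
    (hf : f ∈ H.dirichletForm.dom) : ∃ g : ℕ → C(K, ℝ), (∀ m, g m ∈ H.pharm m) ∧
      Tendsto (fun m => H.dirichletForm.form (f - g m) (f - g m)) atTop (𝓝 0) := by
  choose g hg hgb hgE hgo using fun m => H.exists_interp m f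
  refine ⟨g, hg, ?_⟩
  -- Pythagoras: the interpolant has energy E⁽ᵐ⁾(f,f) and is orthogonal to the error.
  have h1 : ∀ m, H.dirichletForm.form (f - g m) (f - g m)
      = H.dirichletForm.form f f - H.En m f f := by
    intro m
    have hgd := H.pharm_le_dom (hg m)
    refine tendsto_nhds_unique (H.tendsto_form (H.sub_mem_dom hf hgd) (H.sub_mem_dom hf hgd)) ?_
    refine ((H.tendsto_form hf hf).sub_const _).congr' ?_
    filter_upwards [eventually_ge_atTop m] with k hk
    rw [ContinuousMap.coe_sub, En_sub_left, En_sub_right, En_sub_right, H.En_comm k f (g m),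
      H.En_pharm (hg m) hk, H.En_pharm (hg m) hk, hgE, hgE, H.En_comm m f (g m), hgE]
    ring
  simp_rw [h1]
  simpa using (H.tendsto_form hf hf).const_sub (H.dirichletForm.form f f)

/-- If `g n` has bounded energy and converges pointwise to a constant, then it converges to zero
weakly in energy. -/
lemma tendsto_form_of_tendsto_const (H : HarmonicStructure L) {f : C(K, ℝ)}
    (hf : f ∈ H.dirichletForm.dom) {g : ℕ → C(K, ℝ)} (hg : ∀ n, g n ∈ H.dirichletForm.dom) {B a : ℝ}
    (hB : ∀ n, H.dirichletForm.form (g n) (g n) ≤ B)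
    (ha : ∀ x, Tendsto (fun n => g n x) atTop (𝓝 a)) :
    Tendsto (fun n => H.dirichletForm.form f (g n)) atTop (𝓝 0) := by
  obtain ⟨F, hF, hFf⟩ := H.exists_pharm_approx hf
  have hB0 : 0 ≤ B := (H.form_nonneg (hg 0)).trans (hB 0)
  refine Metric.tendsto_atTop.2 fun ε hε => ?_
  -- Young then bounds the pairing with f - F by 3ε/4, leaving ε/4 for the pairing with F, which
  -- involves finitely many points and so follows from pointwise convergence.
  set t : ℝ := (B + 1) / ε
  have ht : 0 < t := by positivity
  obtain ⟨m, hm⟩ := (hFf.eventually_lt_const (show 0 < ε / (2 * t) by positivity)).exists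
  have hFd := H.pharm_le_dom (hF m)
  have h1 : Tendsto (fun n => H.En m (F m) (g n)) atTop (𝓝 0) := by
    simp only [En_eq]
    have : Tendsto (fun n => ∑ e : Edge L m, H.wt m e * ((F m (src m e) - F m (tgt m e)) *
        (g n (src m e) - g n (tgt m e)))) atTop
        (𝓝 (∑ e : Edge L m, H.wt m e * ((F m (src m e) - F m (tgt m e)) * (a - a)))) :=
      tendsto_finsetSum _ fun e _ => (((ha _).sub (ha _)).const_mul _).const_mul _
    simpa using this
  obtain ⟨n0, hn0⟩ := Metric.tendsto_atTop.1 h1 (ε / 4) (by positivity)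
  refine ⟨n0, fun n hn => ?_⟩
  have h2 := hn0 n hn
  rw [Real.dist_eq, sub_zero] at h2 ⊢
  have h3 : H.dirichletForm.form f (g n)
      = H.dirichletForm.form (f - F m) (g n) + H.En m (F m) (g n) := by
    rw [← H.form_pharm (hF m), ← H.form_add_left (H.sub_mem_dom hf hFd) hFd (hg n), sub_add_cancel]
  have h4 := H.two_mul_abs_form_le (H.sub_mem_dom hf hFd) (hg n) ht
  have h5 : t * H.dirichletForm.form (f - F m) (f - F m) ≤ ε / 2 := by
    calc _ ≤ t * (ε / (2 * t)) := mul_le_mul_of_nonneg_left hm.le ht.le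
      _ = ε / 2 := by field_simp
  have h6 : t⁻¹ * H.dirichletForm.form (g n) (g n) ≤ ε := by
    calc _ ≤ t⁻¹ * B := mul_le_mul_of_nonneg_left (hB n) (by positivity)
      _ = ε * (B / (B + 1)) := by simp only [t]; field_simp
      _ ≤ ε * 1 := mul_le_mul_of_nonneg_left ((div_le_one (by positivity)).2 (by linarith)) hε.le
      _ = ε := mul_one ε
  rw [h3]
  calc _ ≤ |H.dirichletForm.form (f - F m) (g n)| + |H.En m (F m) (g n)| := abs_add_le _ _
    _ < ε := by linarith

/-- The truncation of a continuous function to `[a - ε, a + ε]`. -/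
def trunc (f : C(K, ℝ)) (a ε : ℝ) : C(K, ℝ) where
  toFun x := max (a - ε) (min (a + ε) (f x))
  continuous_toFun := by fun_prop

omit [CompactSpace K] [T2Space K] [ConnectedSpace K] in
lemma trunc_mem_dom (H : HarmonicStructure L) {f : C(K, ℝ)} (hf : f ∈ H.dirichletForm.dom)
    (a ε : ℝ) : trunc f a ε ∈ H.dirichletForm.dom :=
  (H.mem_dom_iff _).2 ⟨H.dirichletForm.form f f, fun m =>
    (H.En_clamp_le_self m f _ _).trans (H.En_le_form hf m)⟩

/-- The energy of truncations to small intervals tends to zero. -/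
lemma tendsto_form_trunc (H : HarmonicStructure L) {f : C(K, ℝ)} (hf : f ∈ H.dirichletForm.dom)
    (a : ℝ) {ε : ℕ → ℝ} (hε0 : ∀ n, 0 < ε n) (hε : Tendsto ε atTop (𝓝 0)) :
    Tendsto (fun n => H.dirichletForm.form (trunc f a (ε n)) (trunc f a (ε n))) atTop (𝓝 0) := by
  -- The truncations T converge weakly to 0 in energy; since E(T,T) ≤ E(f,T), weak convergence
  -- already gives strong convergence.
  have h1 : Tendsto (fun n => H.dirichletForm.form f (trunc f a (ε n))) atTop (𝓝 0) := by
    refine H.tendsto_form_of_tendsto_const hf (fun n => H.trunc_mem_dom hf a (ε n))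
      (B := H.dirichletForm.form f f) (a := a) (fun n => ?_) fun x => ?_
    · have hd := H.trunc_mem_dom hf a (ε n)
      exact le_of_tendsto_of_tendsto' (H.tendsto_form hd hd) (H.tendsto_form hf hf)
        fun m => H.En_clamp_le_self m f _ _
    · have hl : Tendsto (fun n => a - ε n) atTop (𝓝 a) := by simpa using hε.const_sub a
      have hu : Tendsto (fun n => a + ε n) atTop (𝓝 a) := by simpa using hε.const_add a
      refine tendsto_of_tendsto_of_tendsto_of_le_of_le hl hu (fun n => le_max_left _ _)
        fun n => max_le (by linarith [hε0 n]) (min_le_left _ _)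
  refine squeeze_zero (fun n => H.form_nonneg (H.trunc_mem_dom hf a (ε n))) (fun n => ?_) h1
  have hd := H.trunc_mem_dom hf a (ε n)
  exact le_of_tendsto_of_tendsto' (H.tendsto_form hd hd) (H.tendsto_form hf hd)
    fun m => H.En_clamp_le m f _ _

end HarmonicStructure

namespace HarmonicStructure

variable {K : Type*} [TopologicalSpace K] {N : ℕ} {L : PCFStructure K N}

/-! ## Energy measures -/

/-- Makes positivity visible: each edge charges its two ends with the weighted squared increment of
f. -/
lemma two_mul_En_sub_En (H : HarmonicStructure L) (m : ℕ) (f φ : K → ℝ) :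
    2 * H.En m (f * φ) f - H.En m φ (f ^ 2)
      = ∑ e : Edge L m, H.wt m e * (f (src m e) - f (tgt m e)) ^ 2 *
          (φ (src m e) + φ (tgt m e)) := by
  simp only [En_eq, Finset.mul_sum, ← Finset.sum_sub_distrib, Pi.mul_apply, Pi.pow_apply]
  exact Finset.sum_congr rfl fun e _ => by ring

variable [CompactSpace K] [TopologicalSpace.MetrizableSpace K] [ConnectedSpace K]
  [MeasurableSpace K] [BorelSpace K]

omit [CompactSpace K] [ConnectedSpace K] in
/-- The discrete approximations of the energy measure. -/
lemma exists_discreteEnergyMeasure (H : HarmonicStructure L) (f : C(K, ℝ)) (m : ℕ) :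
    ∃ μ : FiniteMeasure K, ∀ φ : C(K, ℝ),
      ∫ x, φ x ∂(μ : Measure K) = 2 * H.En m (f * φ) f - H.En m φ (f ^ 2) := by
  set c : Edge L m → ENNReal :=
    fun e => ENNReal.ofReal (H.wt m e * (f (src m e) - f (tgt m e)) ^ 2)
  have hc : ∀ e, c e ≠ ⊤ := fun e => ENNReal.ofReal_ne_top
  have hfin : ∀ e, IsFiniteMeasure (c e • (Measure.dirac (src m e) + Measure.dirac (tgt m e))) :=
    fun e => Measure.smul_finite _ (hc e)
  refine ⟨⟨∑ e, c e • (Measure.dirac (src m e) + Measure.dirac (tgt m e)), inferInstance⟩,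
    fun φ => ?_⟩
  have hi : ∀ x, Integrable φ (Measure.dirac x) := fun x => integrable_dirac (by simp)
  rw [two_mul_En_sub_En, FiniteMeasure.toMeasure_mk, integral_finsetSum_measure]
  · refine Finset.sum_congr rfl fun e _ => ?_
    rw [integral_smul_measure, integral_add_measure (hi _) (hi _), integral_dirac, integral_dirac,
      ENNReal.toReal_ofReal (mul_nonneg (H.wt_nonneg m e) (sq_nonneg _)), smul_eq_mul]
  · exact fun e _ => ((hi _).add_measure (hi _)).smul_measure (hc e)

omit [ConnectedSpace K] in
-- The discrete measures have mass 2E⁽ᵐ⁾(f,f) ≤ 2E(f,f), so they converge weakly along an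
-- ultrafilter; domain functions have convergent integrals, which identifies the limit.
lemma exists_energyMeasure (H : HarmonicStructure L) {f : C(K, ℝ)}
    (hf : f ∈ H.dirichletForm.dom) : ∃ ν : FiniteMeasure K, H.dirichletForm.IsEnergyMeasure f ν := by
  choose μ hμ using H.exists_discreteEnergyMeasure f
  set B : NNReal := Real.toNNReal (2 * H.dirichletForm.form f f)
  have hB : ∀ m, (μ m).mass ≤ B := by
    intro m
    have h1 := hμ m 1
    have h2 : H.En m (f * (1 : C(K, ℝ))) f = H.En m f f := by simp
    rw [h2, show H.En m (1 : C(K, ℝ)) (f ^ 2) = 0 from H.En_const_left m 1 _] at h1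
    simp only [ContinuousMap.one_apply, integral_const, smul_eq_mul, mul_one, sub_zero] at h1
    rw [Real.le_toNNReal_iff_coe_le (by linarith [H.form_nonneg hf])]
    have h3 : ((μ m).mass : ℝ) = (μ m : Measure K).real Set.univ := rfl
    rw [h3, h1]
    linarith [H.En_le_form hf m]
  obtain ⟨ν, -, hν⟩ := (isCompact_setOfPred_finiteMeasure_le_of_compactSpace K
    B).ultrafilter_le_nhds ((hyperfilter ℕ).map μ) (by
      rw [le_principal_iff]
      exact (Eventually.of_forall hB :
        ∀ᶠ m in (hyperfilter ℕ : Filter ℕ), (μ m).mass ≤ B))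
  refine ⟨ν, fun φ hφ => ?_⟩
  have h1 := FiniteMeasure.tendsto_iff_forall_integral_tendsto.1
    (show Tendsto μ (hyperfilter ℕ) (𝓝 ν) from hν) (BoundedContinuousFunction.mkOfCompact φ)
  simp only [BoundedContinuousFunction.mkOfCompact_apply] at h1
  refine tendsto_nhds_unique h1 ?_
  have h2 := ((H.tendsto_form (H.mul_mem_dom hf hφ) hf).const_mul 2).sub
    (H.tendsto_form hφ (H.sq_mem_dom hf))
  refine (h2.mono_left Nat.hyperfilter_le_atTop).congr fun m => ?_
  rw [hμ, ContinuousMap.coe_mul, ContinuousMap.coe_pow]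

lemma isEnergyMeasure (H : HarmonicStructure L) {f : C(K, ℝ)} (hf : f ∈ H.dirichletForm.dom) :
    H.dirichletForm.IsEnergyMeasure f (H.dirichletForm.energyMeasure f) := by
  rw [ContinuousForm.energyMeasure, dif_pos (H.exists_energyMeasure hf)]
  exact (H.exists_energyMeasure hf).choose_spec

omit [ConnectedSpace K] [TopologicalSpace.MetrizableSpace K] in
lemma integrable_of_continuousMap (φ : C(K, ℝ)) (μ : Measure K) [IsFiniteMeasure μ] :
    Integrable φ μ :=
  (BoundedContinuousFunction.mkOfCompact φ).integrable μ

/-- Finite measures are determined by the integrals of the functions of the domain. -/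
lemma measure_ext (H : HarmonicStructure L) {μ ν : Measure K} [IsFiniteMeasure μ]
    [IsFiniteMeasure ν] (h : ∀ φ ∈ H.dirichletForm.dom, ∫ x, φ x ∂μ = ∫ x, φ x ∂ν) : μ = ν := by
  refine ext_of_forall_integral_eq_of_IsFiniteMeasure fun u => ?_
  have key : ∀ ε : ℝ, 0 < ε → |∫ x, u x ∂μ - ∫ x, u x ∂ν|
      ≤ ε * (μ.real Set.univ + ν.real Set.univ) := by
    intro ε hε
    obtain ⟨g, hg, hgu⟩ := H.exists_mem_dom_near u.toContinuousMap hε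
    have h1 : ∀ (ρ : Measure K) [IsFiniteMeasure ρ],
        |∫ x, u x ∂ρ - ∫ x, g x ∂ρ| ≤ ε * ρ.real Set.univ := by
      intro ρ _
      rw [← integral_sub (u.integrable ρ) (integrable_of_continuousMap g ρ)]
      exact norm_integral_le_of_norm_le_const (μ := ρ) (f := fun x => u x - g x)
        (Eventually.of_forall fun x => by
          rw [Real.norm_eq_abs, abs_sub_comm]
          exact hgu x)
    have h2 := h1 μ
    have h3 := h1 ν
    rw [h g hg] at h2
    have h4 : ∫ x, u x ∂μ - ∫ x, u x ∂ν
        = (∫ x, u x ∂μ - ∫ x, g x ∂ν) - (∫ x, u x ∂ν - ∫ x, g x ∂ν) := by ring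
    rw [h4]
    exact (abs_sub _ _).trans (by linarith)
  have hlim : Tendsto (fun ε : ℝ => ε * (μ.real Set.univ + ν.real Set.univ)) (𝓝[>] 0) (𝓝 0) := by
    have : Tendsto (fun ε : ℝ => ε * (μ.real Set.univ + ν.real Set.univ)) (𝓝 0)
        (𝓝 (0 * (μ.real Set.univ + ν.real Set.univ))) := tendsto_id.mul_const _
    rw [zero_mul] at this
    exact this.mono_left nhdsWithin_le_nhds
  have h0 := ge_of_tendsto hlim (by filter_upwards [self_mem_nhdsWithin] with ε hε using key ε hε)
  exact sub_eq_zero.1 (abs_eq_zero.1 (le_antisymm h0 (abs_nonneg _)))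

/-- A linear relation between integrals of functions of the domain is one between measures. -/
lemma sum_measureReal_eq_zero (H : HarmonicStructure L) {ι : Type*} [Fintype ι] (a : ι → ℝ)
    (μ : ι → Measure K) [∀ i, IsFiniteMeasure (μ i)]
    (h : ∀ φ ∈ H.dirichletForm.dom, ∑ i, a i * ∫ x, φ x ∂(μ i) = 0) (A : Set K) :
    ∑ i, a i * (μ i).real A = 0 := by
  -- `ENNReal.ofReal` keeps positive parts of coefficients, so the relation becomes equality of the
  -- positive measures `P a` and `P (-a)`.
  set P : (ι → ℝ) → Measure K := fun b => ∑ i, ENNReal.ofReal (b i) • μ i with hP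
  have hfin : ∀ b, IsFiniteMeasure (P b) := fun b => by
    have : ∀ i, IsFiniteMeasure (ENNReal.ofReal (b i) • μ i) := fun i =>
      Measure.smul_finite _ ENNReal.ofReal_ne_top
    rw [hP]
    infer_instance
  have hint : ∀ b (φ : C(K, ℝ)), ∫ x, φ x ∂(P b) = ∑ i, max (b i) 0 * ∫ x, φ x ∂(μ i) := by
    intro b φ
    rw [hP, integral_finsetSum_measure fun i _ =>
      (integrable_of_continuousMap φ (μ i)).smul_measure ENNReal.ofReal_ne_top]
    refine Finset.sum_congr rfl fun i _ => ?_
    rw [integral_smul_measure, ENNReal.toReal_ofReal', smul_eq_mul]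
  have hreal : ∀ b, (P b).real A = ∑ i, max (b i) 0 * (μ i).real A := by
    intro b
    rw [hP, Measure.real, Measure.finsetSum_apply, ENNReal.toReal_sum fun i _ => by
      rw [Measure.smul_apply]
      exact ENNReal.mul_ne_top ENNReal.ofReal_ne_top (measure_ne_top _ _)]
    refine Finset.sum_congr rfl fun i _ => ?_
    rw [Measure.smul_apply, smul_eq_mul, ENNReal.toReal_mul, ENNReal.toReal_ofReal']
    rfl
  have hsplit : ∀ c : ℝ, max c 0 - max (-c) 0 = c := fun c => by
    rcases le_total 0 c with h | h
    · rw [max_eq_left h, max_eq_right (by linarith)]; ring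
    · rw [max_eq_right h, max_eq_left (by linarith)]; ring
  have heq : P a = P fun i => -a i := by
    refine H.measure_ext fun φ hφ => ?_
    rw [hint, hint, ← sub_eq_zero, ← Finset.sum_sub_distrib]
    refine Eq.trans ?_ (h φ hφ)
    refine Finset.sum_congr rfl fun i _ => ?_
    rw [← sub_mul, hsplit]
  have h1 := congrArg (fun ρ : Measure K => ρ.real A) heq
  simp only [hreal] at h1
  rw [← sub_eq_zero, ← Finset.sum_sub_distrib] at h1
  rw [← h1]
  refine Finset.sum_congr rfl fun i _ => ?_
  rw [← sub_mul, hsplit]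

/-- The energy measure of a set as a real number. -/
abbrev nm (H : HarmonicStructure L) (f : C(K, ℝ)) (A : Set K) : ℝ :=
  (H.dirichletForm.energyMeasure f : Measure K).real A

lemma nm_univ (H : HarmonicStructure L) {f : C(K, ℝ)} (hf : f ∈ H.dirichletForm.dom) :
    H.nm f Set.univ = 2 * H.dirichletForm.form f f := by
  have h := H.isEnergyMeasure hf 1 H.one_mem_dom
  rw [mul_one, show H.dirichletForm.form 1 (f ^ 2) = 0 from H.form_eq_of_eventually
    (Eventually.of_forall fun m => H.En_const_left m 1 _)] at h
  simpa using h

/-- The polarized form of the expression that determines the energy measure. -/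
def polar (H : HarmonicStructure L) (f g φ : C(K, ℝ)) : ℝ :=
  H.dirichletForm.form (f * φ) g + H.dirichletForm.form (g * φ) f - H.dirichletForm.form φ (f * g)

lemma integral_energyMeasure (H : HarmonicStructure L) {f φ : C(K, ℝ)}
    (hf : f ∈ H.dirichletForm.dom) (hφ : φ ∈ H.dirichletForm.dom) :
    ∫ x, φ x ∂(H.dirichletForm.energyMeasure f : Measure K) = H.polar f f φ := by
  rw [H.isEnergyMeasure hf φ hφ, polar, sq]
  ring

omit [CompactSpace K] [TopologicalSpace.MetrizableSpace K] [ConnectedSpace K]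
  [MeasurableSpace K] [BorelSpace K] in
lemma polar_comm (H : HarmonicStructure L) (f g φ : C(K, ℝ)) :
    H.polar f g φ = H.polar g f φ := by
  unfold polar
  rw [mul_comm g f]
  ring

omit [TopologicalSpace.MetrizableSpace K] [ConnectedSpace K] [MeasurableSpace K]
  [BorelSpace K] in
lemma polar_add_left (H : HarmonicStructure L) {f f' g φ : C(K, ℝ)}
    (hf : f ∈ H.dirichletForm.dom) (hf' : f' ∈ H.dirichletForm.dom)
    (hg : g ∈ H.dirichletForm.dom) (hφ : φ ∈ H.dirichletForm.dom) :
    H.polar (f + f') g φ = H.polar f g φ + H.polar f' g φ := by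
  unfold polar
  rw [add_mul, add_mul, H.form_add_left (H.mul_mem_dom hf hφ) (H.mul_mem_dom hf' hφ) hg,
    H.form_add_right (H.mul_mem_dom hg hφ) hf hf',
    H.form_add_right hφ (H.mul_mem_dom hf hg) (H.mul_mem_dom hf' hg)]
  ring

omit [TopologicalSpace.MetrizableSpace K] [ConnectedSpace K] [MeasurableSpace K]
  [BorelSpace K] in
lemma polar_smul_left (H : HarmonicStructure L) (c : ℝ) {f g φ : C(K, ℝ)}
    (hf : f ∈ H.dirichletForm.dom) (hg : g ∈ H.dirichletForm.dom)
    (hφ : φ ∈ H.dirichletForm.dom) : H.polar (c • f) g φ = c * H.polar f g φ := by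
  unfold polar
  rw [smul_mul_assoc, smul_mul_assoc, H.form_smul_left c (H.mul_mem_dom hf hφ) hg,
    H.form_smul_right c (H.mul_mem_dom hg hφ) hf,
    H.form_smul_right c hφ (H.mul_mem_dom hf hg)]
  ring

/-- The mutual energy measure of a set. -/
abbrev mm (H : HarmonicStructure L) (f g : C(K, ℝ)) (A : Set K) : ℝ :=
  H.dirichletForm.mutualEnergyMeasure f g A

omit [CompactSpace K] [TopologicalSpace.MetrizableSpace K] [ConnectedSpace K]
  [BorelSpace K] in
lemma mm_eq (H : HarmonicStructure L) (f g : C(K, ℝ)) {A : Set K} (hA : MeasurableSet A) :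
    H.mm f g A = (H.nm (f + g) A - H.nm f A - H.nm g A) / 2 := by
  simp only [mm, ContinuousForm.mutualEnergyMeasure, _root_.smul_apply,
    _root_.sub_apply, Measure.toSignedMeasure_apply_measurable hA, smul_eq_mul]
  ring

/-- Linear relations between mutual energy measures. -/
lemma sum_mm_eq_zero (H : HarmonicStructure L) {ι : Type*} [Fintype ι] (a : ι → ℝ)
    (f g : ι → C(K, ℝ)) (hf : ∀ i, f i ∈ H.dirichletForm.dom)
    (hg : ∀ i, g i ∈ H.dirichletForm.dom)
    (h : ∀ φ ∈ H.dirichletForm.dom, ∑ i, a i * H.polar (f i) (g i) φ = 0)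
    {A : Set K} (hA : MeasurableSet A) : ∑ i, a i * H.mm (f i) (g i) A = 0 := by
  have h1 := H.sum_measureReal_eq_zero (ι := ι × Fin 3)
    (fun i => a i.1 * ![1 / 2, -1 / 2, -1 / 2] i.2)
    (fun i => (H.dirichletForm.energyMeasure (![f i.1 + g i.1, f i.1, g i.1] i.2) : Measure K))
    (fun φ hφ => by
      rw [Fintype.sum_prod_type, ← h φ hφ]
      refine Finset.sum_congr rfl fun i _ => ?_
      simp only [Fin.sum_univ_three, Matrix.cons_val_zero, Matrix.cons_val_one, Matrix.cons_val]
      have hfg := H.add_mem_dom (hf i) (hg i)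
      rw [H.integral_energyMeasure hfg hφ, H.integral_energyMeasure (hf i) hφ,
        H.integral_energyMeasure (hg i) hφ, H.polar_add_left (hf i) (hg i) hfg hφ,
        H.polar_comm (f i) (f i + g i), H.polar_comm (g i) (f i + g i),
        H.polar_add_left (hf i) (hg i) (hf i) hφ, H.polar_add_left (hf i) (hg i) (hg i) hφ,
        H.polar_comm (g i) (f i)]
      ring) A
  rw [Fintype.sum_prod_type] at h1
  rw [← h1]
  refine Finset.sum_congr rfl fun i _ => ?_
  simp only [Fin.sum_univ_three, Matrix.cons_val_zero, Matrix.cons_val_one, Matrix.cons_val]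
  rw [H.mm_eq _ _ hA]
  ring

omit [CompactSpace K] [TopologicalSpace.MetrizableSpace K] [ConnectedSpace K] [BorelSpace K] in
lemma mm_comm (H : HarmonicStructure L) (f g : C(K, ℝ)) (A : Set K) :
    H.mm f g A = H.mm g f A := by
  simp only [mm, ContinuousForm.mutualEnergyMeasure, _root_.smul_apply,
    _root_.sub_apply, add_comm g f, smul_eq_mul]
  ring

lemma mm_add_left (H : HarmonicStructure L) {f f' g : C(K, ℝ)}
    (hf : f ∈ H.dirichletForm.dom) (hf' : f' ∈ H.dirichletForm.dom)
    (hg : g ∈ H.dirichletForm.dom) {A : Set K} (hA : MeasurableSet A) :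
    H.mm (f + f') g A = H.mm f g A + H.mm f' g A := by
  have h := H.sum_mm_eq_zero (ι := Fin 3) ![1, -1, -1] ![f + f', f, f'] ![g, g, g]
    (fun i => by fin_cases i <;> simp [hf, hf', H.add_mem_dom hf hf'])
    (fun i => by fin_cases i <;> simp [hg])
    (fun φ hφ => by
      simp only [Fin.sum_univ_three, Matrix.cons_val_zero, Matrix.cons_val_one, Matrix.cons_val]
      rw [H.polar_add_left hf hf' hg hφ]
      ring) hA
  simp only [Fin.sum_univ_three, Matrix.cons_val_zero, Matrix.cons_val_one, Matrix.cons_val] at h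
  linarith

lemma mm_smul_left (H : HarmonicStructure L) (c : ℝ) {f g : C(K, ℝ)}
    (hf : f ∈ H.dirichletForm.dom) (hg : g ∈ H.dirichletForm.dom) {A : Set K}
    (hA : MeasurableSet A) : H.mm (c • f) g A = c * H.mm f g A := by
  have h := H.sum_mm_eq_zero (ι := Fin 2) ![1, -c] ![c • f, f] ![g, g]
    (fun i => by fin_cases i <;> simp [hf, H.smul_mem_dom c hf])
    (fun i => by fin_cases i <;> simp [hg])
    (fun φ hφ => by
      simp only [Fin.sum_univ_two, Matrix.cons_val_zero, Matrix.cons_val_one]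
      rw [H.polar_smul_left c hf hg hφ]
      ring) hA
  simp only [Fin.sum_univ_two, Matrix.cons_val_zero, Matrix.cons_val_one] at h
  linarith

lemma mm_self (H : HarmonicStructure L) {f : C(K, ℝ)} (hf : f ∈ H.dirichletForm.dom) {A : Set K}
    (hA : MeasurableSet A) : H.mm f f A = H.nm f A := by
  have hf2 := H.smul_mem_dom 2 hf
  have h := H.sum_measureReal_eq_zero (ι := Fin 2) ![1, -4]
    (fun i => (H.dirichletForm.energyMeasure (![(2 : ℝ) • f, f] i) : Measure K))
    (fun φ hφ => by
      simp only [Fin.sum_univ_two, Matrix.cons_val_zero, Matrix.cons_val_one]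
      rw [H.integral_energyMeasure hf2 hφ, H.integral_energyMeasure hf hφ,
        H.polar_smul_left 2 hf hf2 hφ, H.polar_comm f, H.polar_smul_left 2 hf hf hφ]
      ring) A
  simp only [Fin.sum_univ_two, Matrix.cons_val_zero, Matrix.cons_val_one] at h
  rw [H.mm_eq _ _ hA, ← two_smul ℝ f]
  simp only [nm]
  linarith

/-- The mutual energy measures are controlled by the energy measures. -/
lemma two_mul_abs_mm_le (H : HarmonicStructure L) {f g : C(K, ℝ)}
    (hf : f ∈ H.dirichletForm.dom) (hg : g ∈ H.dirichletForm.dom) {t : ℝ} (ht : 0 < t)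
    {A : Set K} (hA : MeasurableSet A) :
    2 * |H.mm f g A| ≤ t * H.nm f A + t⁻¹ * H.nm g A := by
  have key : ∀ s : ℝ, s ^ 2 = 1 → 2 * (s * H.mm f g A) ≤ t * H.nm f A + t⁻¹ * H.nm g A := by
    intro s hs
    have hu := H.smul_mem_dom t hf
    have hv := H.smul_mem_dom (-s) hg
    have huv := H.add_mem_dom hu hv
    have h0 : 0 ≤ H.nm (t • f + (-s) • g) A := measureReal_nonneg
    rw [← H.mm_self huv hA, H.mm_add_left hu hv huv hA, H.mm_smul_left _ hf huv hA,
      H.mm_smul_left _ hg huv hA, H.mm_comm f, H.mm_comm g, H.mm_add_left hu hv hf hA,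
      H.mm_add_left hu hv hg hA, H.mm_smul_left _ hf hf hA, H.mm_smul_left _ hg hf hA,
      H.mm_smul_left _ hf hg hA, H.mm_smul_left _ hg hg hA, H.mm_comm g f, H.mm_self hf hA,
      H.mm_self hg hA] at h0
    have h1 := mul_nonneg (inv_nonneg.2 ht.le) h0
    have h2 : t⁻¹ * (t * (t * H.nm f A + -s * H.mm f g A)
        + -s * (t * H.mm f g A + -s * H.nm g A))
        = t * H.nm f A - 2 * (s * H.mm f g A) + t⁻¹ * (s ^ 2 * H.nm g A) := by
      field_simp
      ring
    rw [h2, hs] at h1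
    linarith
  rcases abs_cases (H.mm f g A) with ⟨h, _⟩ | ⟨h, _⟩ <;> rw [h]
  · simpa using key 1 (by norm_num)
  · simpa using key (-1) (by norm_num)

/-! ## Self-similarity of the energy measures -/

omit [CompactSpace K] [TopologicalSpace.MetrizableSpace K] [ConnectedSpace K] in
lemma measurable_ψ (i : Fin N) : Measurable (L.ψ i) := (L.continuous_ψ i).measurable

/-- Pull-back respects products and the form splits over cells, so both sides integrate every domain
function equally. -/
lemma energyMeasure_eq_sum (H : HarmonicStructure L) {f : C(K, ℝ)}
    (hf : f ∈ H.dirichletForm.dom) :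
    (H.dirichletForm.energyMeasure f : Measure K) = ∑ i, ENNReal.ofReal (H.r i)⁻¹ •
      (H.dirichletForm.energyMeasure (pull L i f) : Measure K).map (L.ψ i) := by
  have hfin : ∀ i, IsFiniteMeasure (ENNReal.ofReal (H.r i)⁻¹ •
      (H.dirichletForm.energyMeasure (pull L i f) : Measure K).map (L.ψ i)) := fun i =>
    Measure.smul_finite _ ENNReal.ofReal_ne_top
  refine H.measure_ext fun φ hφ => ?_
  rw [integral_finsetSum_measure fun i _ => integrable_of_continuousMap φ _,
    H.isEnergyMeasure hf φ hφ, H.form_eq_sum_pull (H.mul_mem_dom hf hφ) hf, H.form_eq_sum_pull hφ (H.sq_mem_dom hf),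
    Finset.mul_sum, ← Finset.sum_sub_distrib]
  refine Finset.sum_congr rfl fun i _ => ?_
  rw [integral_smul_measure, ENNReal.toReal_ofReal (inv_nonneg.2 (H.r_pos i).le), smul_eq_mul,
    integral_map (measurable_ψ i).aemeasurable φ.continuous.aestronglyMeasurable]
  have h := H.isEnergyMeasure (H.pull_mem_dom hf i) (pull L i φ) (H.pull_mem_dom hφ i)
  simp only [pull_apply] at h
  rw [h, sq, sq, pull_mul, pull_mul]
  ring

lemma nm_eq_sum (H : HarmonicStructure L) {f : C(K, ℝ)} (hf : f ∈ H.dirichletForm.dom) {A : Set K}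
    (hA : MeasurableSet A) : H.nm f A = ∑ i, (H.r i)⁻¹ * H.nm (pull L i f) (L.ψ i ⁻¹' A) := by
  rw [nm, H.energyMeasure_eq_sum hf, Measure.real, Measure.finsetSum_apply,
    ENNReal.toReal_sum fun i _ => by
      rw [Measure.smul_apply]
      exact ENNReal.mul_ne_top ENNReal.ofReal_ne_top (measure_ne_top _ _)]
  refine Finset.sum_congr rfl fun i _ => ?_
  rw [Measure.smul_apply, smul_eq_mul, ENNReal.toReal_mul,
    ENNReal.toReal_ofReal (inv_nonneg.2 (H.r_pos i).le), Measure.map_apply (measurable_ψ i) hA]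
  rfl

lemma mm_eq_sum (H : HarmonicStructure L) {f g : C(K, ℝ)} (hf : f ∈ H.dirichletForm.dom)
    (hg : g ∈ H.dirichletForm.dom) {A : Set K} (hA : MeasurableSet A) :
    H.mm f g A = ∑ i, (H.r i)⁻¹ * H.mm (pull L i f) (pull L i g) (L.ψ i ⁻¹' A) := by
  rw [H.mm_eq _ _ hA, H.nm_eq_sum (H.add_mem_dom hf hg) hA, H.nm_eq_sum hf hA, H.nm_eq_sum hg hA,
    ← Finset.sum_sub_distrib, ← Finset.sum_sub_distrib, Finset.sum_div]
  refine Finset.sum_congr rfl fun i _ => ?_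
  rw [H.mm_eq _ _ (measurable_ψ i hA), map_add]
  ring

/-! ## Energy measures have no atoms -/

/-- Locality: by self-similarity only the level m cells containing x contribute to the mass at x. -/
lemma nm_singleton_congr (H : HarmonicStructure L) (m : ℕ) {f g : C(K, ℝ)}
    (hf : f ∈ H.dirichletForm.dom) (hg : g ∈ H.dirichletForm.dom) (x : K)
    (h : ∀ ω τ : ℕ → Fin N, L.π ω = x → (∀ k < m, ω k = τ k) → f (L.π τ) = g (L.π τ)) :
    H.nm f {x} = H.nm g {x} := by
  induction m generalizing f g x with
  | zero =>
    obtain ⟨ω, hω⟩ := L.surjective_π x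
    have : f = g := by
      ext y
      obtain ⟨τ, rfl⟩ := L.surjective_π y
      exact h ω τ hω (by simp)
    rw [this]
  | succ m ih =>
    rw [H.nm_eq_sum hf (measurableSet_singleton x), H.nm_eq_sum hg (measurableSet_singleton x)]
    refine Finset.sum_congr rfl fun i _ => ?_
    congr 1
    by_cases hx : ∃ y, L.ψ i y = x
    · obtain ⟨y, rfl⟩ := hx
      rw [show L.ψ i ⁻¹' {L.ψ i y} = {y} by ext z; simp [(L.injective_ψ i).eq_iff]]
      refine ih (H.pull_mem_dom hf i) (H.pull_mem_dom hg i) y fun ω τ hω hωτ => ?_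
      rw [pull_apply, pull_apply, L.ψ_π]
      refine h (wordCons i ω) _ (by rw [← L.ψ_π, hω]) fun k hk => ?_
      cases k with
      | zero => rfl
      | succ k => exact hωτ k (by omega)
    · have : L.ψ i ⁻¹' {x} = ∅ := by
        ext y
        simpa using fun hy => hx ⟨y, hy⟩
      rw [this]
      simp

/-- On small cells around x, f equals its truncation to [f(x) - ε, f(x) + ε]; the atom is at most
the total mass of the truncation's energy measure, which tends to 0. -/
lemma nm_singleton (H : HarmonicStructure L) {f : C(K, ℝ)} (hf : f ∈ H.dirichletForm.dom) (x : K) :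
    H.nm f {x} = 0 := by
  refine le_antisymm ?_ measureReal_nonneg
  set ε : ℕ → ℝ := fun n => 1 / ((n : ℝ) + 1)
  have hε0 : ∀ n, 0 < ε n := fun n => by positivity
  have h1 := (H.tendsto_form_trunc hf (f x) hε0 tendsto_one_div_add_atTop_nhds_zero_nat).const_mul 2
  rw [mul_zero] at h1
  refine ge_of_tendsto' h1 fun n => ?_
  have hd := H.trunc_mem_dom hf (f x) (ε n)
  obtain ⟨m, hm⟩ := L.exists_level_lt f (hε0 n)
  rw [← H.nm_univ hd, H.nm_singleton_congr m hf hd x]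
  · exact measureReal_mono (Set.subset_univ _)
  · intro ω τ hω hωτ
    have h2 := abs_lt.1 (hm ω τ hωτ)
    rw [hω] at h2
    change _ = max (f x - ε n) (min (f x + ε n) (f (L.π τ)))
    rw [min_eq_right (by linarith), max_eq_right (by linarith)]

end HarmonicStructure

/-! ## Semicontinuity and measurability of the rank -/

lemma isOpen_setOf_le_matrix_rank {ι : Type*} [Fintype ι] (n : ℕ) :
    IsOpen {A : ι → ι → ℝ | n ≤ (Matrix.of A).rank} := by
  classical
  let φ : (ι → ι → ℝ) →ₗ[ℝ] ((ι → ℝ) →L[ℝ] (ι → ℝ)) :=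
    LinearMap.toContinuousLinearMap.toLinearMap ∘ₗ
      (Matrix.toLin' (R := ℝ) (m := ι) (n := ι)).toLinearMap ∘ₗ (Matrix.ofLinearEquiv ℝ).toLinearMap
  have hφ : Continuous φ := φ.continuous_of_finiteDimensional
  convert (isOpen_setOfPred_nat_le_rank (𝕜 := ℝ) (E := ι → ℝ) (F := ι → ℝ) n).preimage hφ using 1
  ext A
  change n ≤ (Matrix.of A).rank ↔
    (n : Cardinal) ≤ Module.rank ℝ (LinearMap.range (Matrix.toLin' (Matrix.of A)))
  rw [← Module.finrank_eq_rank, Nat.cast_le]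
  rfl

lemma matrix_rank_le_of_tendsto {ι : Type*} [Fintype ι] {A : ℕ → Matrix ι ι ℝ} {B : Matrix ι ι ℝ}
    (h : ∀ i j, Tendsto (fun k => A k i j) atTop (𝓝 (B i j))) {r : ℕ∞}
    (hr : ∀ k, ((A k).rank : ℕ∞) ≤ r) : (B.rank : ℕ∞) ≤ r := by
  have h1 : Tendsto (fun k => (fun i j => A k i j : ι → ι → ℝ)) atTop (𝓝 fun i j => B i j) :=
    tendsto_pi_nhds.2 fun i => tendsto_pi_nhds.2 fun j => h i j
  obtain ⟨k, hk⟩ := (h1.eventually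
    ((isOpen_setOf_le_matrix_rank B.rank).mem_nhds (by rw [Set.mem_ofPred_eq]; exact le_rfl))).exists
  exact (Nat.cast_le.2 hk).trans (hr k)

lemma measurable_matrix_rank {α ι : Type*} [MeasurableSpace α] [Fintype ι]
    {Z : α → Matrix ι ι ℝ} (h : ∀ i j, Measurable fun x => Z x i j) :
    Measurable fun x => (Z x).rank := by
  have h1 : Measurable fun x => (fun i j => Z x i j : ι → ι → ℝ) :=
    measurable_pi_iff.2 fun i => measurable_pi_iff.2 fun j => h i j
  exact measurable_of_Ici fun n => h1 (isOpen_setOf_le_matrix_rank n).measurableSet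

lemma matrix_rank_smul_le {ι : Type*} [Fintype ι] (s : ℝ) (A : Matrix ι ι ℝ) :
    (s • A).rank ≤ A.rank := by
  classical
  have : s • A = (s • (1 : Matrix ι ι ℝ)) * A := by simp
  rw [this]
  exact Matrix.rank_mul_le_right _ _

lemma measurable_iSup_enat {α : Type*} [MeasurableSpace α] {q : ℕ → α → ℕ∞}
    (h : ∀ m, Measurable (q m)) : Measurable fun x => ⨆ m, q m x := by
  have h1 : ∀ y, MeasurableSet {x | ⨆ m, q m x ≤ y} := by
    intro y
    simp only [iSup_le_iff, Set.ofPred_forall]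
    exact MeasurableSet.iInter fun m => h m (MeasurableSet.of_discrete (s := Set.Iic y))
  refine measurable_to_countable' fun y => ?_
  have h2 : (fun x => ⨆ m, q m x) ⁻¹' {y}
      = {x | ⨆ m, q m x ≤ y} \ ⋃ z ∈ Set.Iio y, {x | ⨆ m, q m x ≤ z} := by
    ext x
    simp only [Set.mem_preimage, Set.mem_singleton_iff, Set.mem_sdiff, Set.mem_ofPred_eq,
      Set.mem_iUnion, Set.mem_Iio, exists_prop, not_exists, not_and, not_le]
    constructor
    · rintro rfl
      exact ⟨le_rfl, fun z hz => hz⟩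
    · rintro ⟨h1, h2⟩
      refine le_antisymm h1 (not_lt.1 fun h3 => ?_)
      exact lt_irrefl _ (h2 _ h3)
  rw [h2]
  exact (h1 y).diff (MeasurableSet.biUnion (Set.to_countable _) fun z _ => h1 z)

namespace HarmonicStructure

variable {K : Type*} [TopologicalSpace K] {N : ℕ} {L : PCFStructure K N}
  [CompactSpace K] [TopologicalSpace.MetrizableSpace K] [ConnectedSpace K]
  [MeasurableSpace K] [BorelSpace K]

/-! ## Densities of mutual energy measures -/

/-- The density of the mutual energy measure of `f` and `g`. -/
abbrev dens (H : HarmonicStructure L) (ν : Measure K) (f g : C(K, ℝ)) : K → ℝ :=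
  (H.dirichletForm.mutualEnergyMeasure f g).rnDeriv ν

section Densities

variable (H : HarmonicStructure L) {ν : Measure K} [IsFiniteMeasure ν]
  (hν : H.dirichletForm.IsEnergyDominant ν)

omit [CompactSpace K] [TopologicalSpace.MetrizableSpace K] [ConnectedSpace K] [BorelSpace K]
  [IsFiniteMeasure ν] in
lemma integrable_dens (f g : C(K, ℝ)) : Integrable (H.dens ν f g) ν :=
  SignedMeasure.integrable_rnDeriv _ _

omit [CompactSpace K] [TopologicalSpace.MetrizableSpace K] [ConnectedSpace K]
  [BorelSpace K] [IsFiniteMeasure ν] in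
lemma dens_comm (f g : C(K, ℝ)) : H.dens ν f g = H.dens ν g f := by
  have : H.dirichletForm.mutualEnergyMeasure f g = H.dirichletForm.mutualEnergyMeasure g f :=
    VectorMeasure.ext fun A _ => H.mm_comm f g A
  rw [dens, this]

include hν

omit [CompactSpace K] [TopologicalSpace.MetrizableSpace K] [ConnectedSpace K]
  [BorelSpace K] in
-- `rnDeriv` recovers only the absolutely continuous part; energy dominance makes that the whole
-- measure.
lemma setIntegral_dens {f g : C(K, ℝ)} (hf : f ∈ H.dirichletForm.dom)
    (hg : g ∈ H.dirichletForm.dom) {A : Set K} (hA : MeasurableSet A) :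
    ∫ x in A, H.dens ν f g x ∂ν = H.mm f g A := by
  rw [← withDensityᵥ_apply (H.integrable_dens f g) hA,
    SignedMeasure.withDensityᵥ_rnDeriv_eq]
  refine VectorMeasure.AbsolutelyContinuous.mk fun s hs h0 => ?_
  rw [Measure.toENNRealVectorMeasure_apply_measurable hs] at h0
  have h1 : ∀ u ∈ H.dirichletForm.dom, H.nm u s = 0 := fun u hu => by
    simp [nm, Measure.real, hν u hu h0]
  change H.mm f g s = 0
  rw [H.mm_eq f g hs, h1 _ (H.add_mem_dom hf hg), h1 _ hf, h1 _ hg]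
  simp

omit [CompactSpace K] [TopologicalSpace.MetrizableSpace K] [ConnectedSpace K]
  [BorelSpace K] in
lemma dens_ae_eq {f g : C(K, ℝ)} (hf : f ∈ H.dirichletForm.dom) (hg : g ∈ H.dirichletForm.dom)
    {φ : K → ℝ} (hφ : Integrable φ ν)
    (h : ∀ A, MeasurableSet A → H.mm f g A = ∫ x in A, φ x ∂ν) : H.dens ν f g =ᵐ[ν] φ :=
  Integrable.ae_eq_of_forall_setIntegral_eq _ _ (H.integrable_dens f g) hφ fun A hA _ => by
    rw [H.setIntegral_dens hν hf hg hA, h A hA]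

lemma dens_add_left {f f' g : C(K, ℝ)} (hf : f ∈ H.dirichletForm.dom)
    (hf' : f' ∈ H.dirichletForm.dom) (hg : g ∈ H.dirichletForm.dom) :
    H.dens ν (f + f') g =ᵐ[ν] fun x => H.dens ν f g x + H.dens ν f' g x := by
  refine H.dens_ae_eq hν (H.add_mem_dom hf hf') hg
    ((H.integrable_dens f g).add (H.integrable_dens f' g)) fun A hA => ?_
  rw [H.mm_add_left hf hf' hg hA, integral_add (H.integrable_dens f g).integrableOn
    (H.integrable_dens f' g).integrableOn, H.setIntegral_dens hν hf hg hA,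
    H.setIntegral_dens hν hf' hg hA]

lemma dens_smul_left (c : ℝ) {f g : C(K, ℝ)} (hf : f ∈ H.dirichletForm.dom)
    (hg : g ∈ H.dirichletForm.dom) :
    H.dens ν (c • f) g =ᵐ[ν] fun x => c * H.dens ν f g x := by
  refine H.dens_ae_eq hν (H.smul_mem_dom c hf) hg
    ((H.integrable_dens f g).const_mul c) fun A hA => ?_
  rw [H.mm_smul_left c hf hg hA, integral_const_mul, H.setIntegral_dens hν hf hg hA]

lemma dens_sum_left {κ : Type*} (s : Finset κ) (c : κ → ℝ) {b : κ → C(K, ℝ)} {g : C(K, ℝ)}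
    (hb : ∀ k, b k ∈ H.dirichletForm.dom) (hg : g ∈ H.dirichletForm.dom) :
    H.dens ν (∑ k ∈ s, c k • b k) g =ᵐ[ν] fun x => ∑ k ∈ s, c k * H.dens ν (b k) g x := by
  classical
  induction s using Finset.induction_on with
  | empty =>
    have := H.dens_smul_left hν 0 hg hg
    simpa using this
  | insert k s hk ih =>
    have h1 : ∑ k ∈ s, c k • b k ∈ H.dirichletForm.dom :=
      H.domSubmodule.sum_mem fun k _ => H.smul_mem_dom (c k) (hb k)
    rw [Finset.sum_insert hk]
    filter_upwards [ih, H.dens_add_left hν (H.smul_mem_dom (c k) (hb k)) h1 hg,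
      H.dens_smul_left hν (c k) (hb k) hg] with x hx1 hx2 hx3
    rw [hx2, hx3, hx1, Finset.sum_insert hk]

/-- The rank of the density matrix of linear combinations of `b`. -/
lemma rank_densityMatrix_le_of_span {ι κ : Type*} [Fintype ι] [Fintype κ] {f : ι → C(K, ℝ)}
    {b : κ → C(K, ℝ)} (hb : ∀ k, b k ∈ H.dirichletForm.dom)
    (hf : ∀ i, f i ∈ Submodule.span ℝ (Set.range b)) :
    ∀ᵐ x ∂ν, (H.dirichletForm.densityMatrix ν f x).rank
      ≤ (H.dirichletForm.densityMatrix ν b x).rank := by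
  choose c hc using fun i => (Submodule.mem_span_range_iff_exists_fun ℝ).1 (hf i)
  have hfd : ∀ i, f i ∈ H.dirichletForm.dom := fun i => by
    rw [← hc i]
    exact H.domSubmodule.sum_mem fun k _ => H.smul_mem_dom _ (hb k)
  have h1 : ∀ i j, ∀ᵐ x ∂ν, H.dens ν (f i) (f j) x
      = ∑ k, c i k * H.dens ν (b k) (f j) x := fun i j => by
    have := H.dens_sum_left hν Finset.univ (c i) hb (hfd j)
    rwa [hc i] at this
  have h2 : ∀ k j, ∀ᵐ x ∂ν, H.dens ν (b k) (f j) x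
      = ∑ l, c j l * H.dens ν (b k) (b l) x := fun k j => by
    have := H.dens_sum_left hν Finset.univ (c j) hb (hb k)
    rw [hc j] at this
    filter_upwards [this] with x hx
    rw [H.dens_comm, hx]
    simp_rw [H.dens_comm (b k)]
  filter_upwards [ae_all_iff.2 fun i => ae_all_iff.2 (h1 i),
    ae_all_iff.2 fun k => ae_all_iff.2 (h2 k)] with x hx1 hx2
  -- Gram matrices transform as C B Cᵀ.
  have h3 : H.dirichletForm.densityMatrix ν f x
      = Matrix.of c * (H.dirichletForm.densityMatrix ν b x * (Matrix.of c).transpose) := by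
    ext i j
    rw [Matrix.mul_apply]
    refine (hx1 i j).trans (Finset.sum_congr rfl fun k _ => ?_)
    rw [hx2, Matrix.mul_apply]
    refine congrArg (c i k * ·) (Finset.sum_congr rfl fun l _ => ?_)
    exact mul_comm _ _
  rw [h3]
  exact (Matrix.rank_mul_le_right _ _).trans (Matrix.rank_mul_le_left _ _)

/-- On the set where the density is nonnegative, and on its complement, the integral is plus or
minus a mutual energy; Young on both pieces adds up to the total masses 2E. -/
lemma integral_abs_dens_le {f g : C(K, ℝ)} (hf : f ∈ H.dirichletForm.dom)
    (hg : g ∈ H.dirichletForm.dom) {t : ℝ} (ht : 0 < t) :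
    ∫ x, |H.dens ν f g x| ∂ν
      ≤ t * H.dirichletForm.form f f + t⁻¹ * H.dirichletForm.form g g := by
  set P : Set K := {x | 0 ≤ H.dens ν f g x}
  have hP : MeasurableSet P :=
    measurableSet_le measurable_const (SignedMeasure.measurable_rnDeriv _ _)
  have h1 : ∫ x in P, |H.dens ν f g x| ∂ν = H.mm f g P := by
    rw [← H.setIntegral_dens hν hf hg hP]
    exact setIntegral_congr_fun hP fun x hx => abs_of_nonneg hx
  have h2 : ∫ x in Pᶜ, |H.dens ν f g x| ∂ν = -H.mm f g Pᶜ := by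
    rw [← H.setIntegral_dens hν hf hg hP.compl, ← integral_neg]
    exact setIntegral_congr_fun hP.compl fun x hx => abs_of_neg (not_le.1 hx)
  rw [← integral_add_compl hP (H.integrable_dens f g).abs, h1, h2]
  have h3 := H.two_mul_abs_mm_le hf hg ht hP
  have h4 := H.two_mul_abs_mm_le hf hg ht hP.compl
  have h5 : ∀ u ∈ H.dirichletForm.dom, H.nm u P + H.nm u Pᶜ = 2 * H.dirichletForm.form u u :=
    fun u hu => by rw [← H.nm_univ hu]; exact measureReal_add_measureReal_compl hP
  have h6 := le_abs_self (H.mm f g P)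
  have h7 := neg_le_abs (H.mm f g Pᶜ)
  have h8 : t * H.nm f P + t * H.nm f Pᶜ = t * (2 * H.dirichletForm.form f f) := by
    rw [← h5 f hf]; ring
  have h9 : t⁻¹ * H.nm g P + t⁻¹ * H.nm g Pᶜ = t⁻¹ * (2 * H.dirichletForm.form g g) := by
    rw [← h5 g hg]; ring
  linarith

lemma tendsto_integral_abs_dens {a : ℕ → C(K, ℝ)} {g : C(K, ℝ)}
    (ha : ∀ m, a m ∈ H.dirichletForm.dom) (hg : g ∈ H.dirichletForm.dom)
    (h : Tendsto (fun m => H.dirichletForm.form (a m) (a m)) atTop (𝓝 0)) :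
    Tendsto (fun m => ∫ x, |H.dens ν (a m) g x| ∂ν) atTop (𝓝 0) := by
  set B := H.dirichletForm.form g g
  have hB : 0 ≤ B := H.form_nonneg hg
  refine Metric.tendsto_atTop.2 fun ε hε => ?_
  set t : ℝ := 2 * (B + 1) / ε
  have ht : 0 < t := by positivity
  obtain ⟨m0, hm0⟩ := eventually_atTop.1
    (h.eventually_lt_const (show 0 < ε / (2 * t) by positivity))
  refine ⟨m0, fun m hm => ?_⟩
  have h1 := H.integral_abs_dens_le hν (ha m) hg ht
  have h2 : t * H.dirichletForm.form (a m) (a m) < ε / 2 := by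
    calc _ < t * (ε / (2 * t)) := mul_lt_mul_of_pos_left (hm0 m hm) ht
      _ = ε / 2 := by field_simp
  have h3 : t⁻¹ * B ≤ ε / 2 := by
    calc t⁻¹ * B = ε / 2 * (B / (B + 1)) := by simp only [t]; field_simp
      _ ≤ ε / 2 * 1 :=
        mul_le_mul_of_nonneg_left ((div_le_one (by positivity)).2 (by linarith)) (by positivity)
      _ = ε / 2 := mul_one _
  rw [Real.dist_eq, sub_zero, abs_of_nonneg (integral_nonneg fun x => abs_nonneg _)]
  linarith

/-- Convergence in energy implies `L¹`-convergence of the densities. -/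
lemma tendsto_integral_abs_dens_sub {f f' : C(K, ℝ)} {g g' : ℕ → C(K, ℝ)}
    (hf : f ∈ H.dirichletForm.dom) (hf' : f' ∈ H.dirichletForm.dom)
    (hg : ∀ m, g m ∈ H.dirichletForm.dom) (hg' : ∀ m, g' m ∈ H.dirichletForm.dom)
    (h : Tendsto (fun m => H.dirichletForm.form (f - g m) (f - g m)) atTop (𝓝 0))
    (h' : Tendsto (fun m => H.dirichletForm.form (f' - g' m) (f' - g' m)) atTop (𝓝 0)) :
    Tendsto (fun m => ∫ x, |H.dens ν f f' x - H.dens ν (g m) (g' m) x| ∂ν) atTop (𝓝 0) := by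
  have hd := fun m => H.sub_mem_dom hf (hg m)
  have hd' := fun m => H.sub_mem_dom hf' (hg' m)
  -- With Γ the density: Γ(f,f') - Γ(g,g') = Γ(f-g,f') + Γ(f'-g',f) - Γ(f-g,f'-g'). The first two
  -- terms keep one argument fixed.
  have h1 := H.tendsto_integral_abs_dens hν hd hf' h
  have h2 := H.tendsto_integral_abs_dens hν hd' hf h'
  have h3 : Tendsto (fun m => ∫ x, |H.dens ν (f - g m) (f' - g' m) x| ∂ν) atTop (𝓝 0) := by
    refine squeeze_zero (fun m => integral_nonneg fun x => abs_nonneg _)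
      (fun m => H.integral_abs_dens_le hν (hd m) (hd' m) one_pos) ?_
    simpa using h.add h'
  refine squeeze_zero (fun m => integral_nonneg fun x => abs_nonneg _) (fun m => ?_)
    (show Tendsto _ atTop (𝓝 (0 : ℝ)) by simpa using (h1.add h2).add h3)
  rw [← integral_add (H.integrable_dens _ _).abs (H.integrable_dens _ _).abs,
    ← integral_add (f := fun x => |H.dens ν (f - g m) f' x| + |H.dens ν (f' - g' m) f x|)
      ((H.integrable_dens _ _).abs.add (H.integrable_dens _ _).abs) (H.integrable_dens _ _).abs]
  refine integral_mono_ae ((H.integrable_dens _ _).sub (H.integrable_dens _ _)).abs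
    (((H.integrable_dens _ _).abs.add (H.integrable_dens _ _).abs).add
      (H.integrable_dens _ _).abs) ?_
  have e1 := H.dens_add_left hν (hd m) (hg m) hf'
  have e2 := H.dens_add_left hν (hd' m) (hg' m) (hg m)
  have e3 := H.dens_add_left hν (hd m) (hg m) (hd' m)
  rw [sub_add_cancel] at e1 e2 e3
  filter_upwards [e1, e2, e3] with x hx1 hx2 hx3
  rw [H.dens_comm f' (g m), H.dens_comm _ (g m), H.dens_comm _ (g m)] at hx2
  rw [H.dens_comm f] at hx3
  rw [hx1, hx2]
  have : H.dens ν (f - g m) f' x + (H.dens ν (g m) (f' - g' m) x + H.dens ν (g m) (g' m) x)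
      - H.dens ν (g m) (g' m) x = H.dens ν (f - g m) f' x + H.dens ν (f' - g' m) f x
        - H.dens ν (f - g m) (f' - g' m) x := by
    rw [hx3]; ring
  rw [this]
  exact (abs_sub _ _).trans (add_le_add (abs_add_le _ _) le_rfl)

end Densities

end HarmonicStructure

namespace HarmonicStructure

variable {K : Type*} [TopologicalSpace K] {N : ℕ} {L : PCFStructure K N}
  [CompactSpace K] [TopologicalSpace.MetrizableSpace K] [ConnectedSpace K]
  [MeasurableSpace K] [BorelSpace K]

/-! ## Self-similarity of the rank -/

section MinimalMeasure

variable (H : HarmonicStructure L) {ν : Measure K} [IsFiniteMeasure ν]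
  (hν : H.dirichletForm.IsMinimalEnergyDominant ν)

include hν

/-- Energy measures have no atoms, so ν without the point x is still energy-dominant, and minimality
makes ν absolutely continuous with respect to it. -/
lemma measure_singleton_eq_zero (x : K) : ν {x} = 0 := by
  have hx : MeasurableSet ({x}ᶜ : Set K) := (measurableSet_singleton x).compl
  have h : H.dirichletForm.IsEnergyDominant (ν.restrict {x}ᶜ) := by
    intro f hf
    refine Measure.AbsolutelyContinuous.mk fun A hA h0 => ?_
    rw [Measure.restrict_apply hA] at h0
    have h1 := hν.domination f hf h0
    have h2 : (H.dirichletForm.energyMeasure f : Measure K) {x} = 0 :=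
      (measureReal_eq_zero_iff (measure_ne_top _ _)).1 (H.nm_singleton hf x)
    refine measure_mono_null (fun y hy => ?_) (measure_union_null h1 h2)
    by_cases hyx : y = x
    · exact Or.inr hyx
    · exact Or.inl ⟨hy, hyx⟩
  refine hν.minimality _ inferInstance h ?_
  rw [Measure.restrict_apply (measurableSet_singleton x)]
  simp

/-- A minimal energy-dominant measure is dominated by the sum of its images under the maps. -/
lemma null_of_preimage_null {A : Set K} (hA : MeasurableSet A) (h : ∀ i, ν (L.ψ i ⁻¹' A) = 0) :
    ν A = 0 := by
  -- Self-similarity of the energy measures makes the sum of images dominant; minimality then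
  -- applies to it.
  have hdom : H.dirichletForm.IsEnergyDominant (∑ i, ν.map (L.ψ i)) := by
    intro f hf
    refine Measure.AbsolutelyContinuous.mk fun B hB h0 => ?_
    rw [Measure.finsetSum_apply, Finset.sum_eq_zero_iff] at h0
    rw [H.energyMeasure_eq_sum hf, Measure.finsetSum_apply]
    refine Finset.sum_eq_zero fun i hi => ?_
    have h1 := h0 i hi
    rw [Measure.map_apply (measurable_ψ i) hB] at h1
    rw [Measure.smul_apply, Measure.map_apply (measurable_ψ i) hB,
      hν.domination _ (H.pull_mem_dom hf i) h1, smul_zero]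
  refine hν.minimality _ inferInstance hdom ?_
  rw [Measure.finsetSum_apply]
  refine Finset.sum_eq_zero fun i _ => ?_
  rw [Measure.map_apply (measurable_ψ i) hA, h i]

omit hν [TopologicalSpace.MetrizableSpace K] [ConnectedSpace K] [MeasurableSpace K]
  [BorelSpace K] [CompactSpace K] in
lemma finite_overlap : {x : K | ∃ i j y z, i ≠ j ∧ L.ψ i y = x ∧ L.ψ j z = x}.Finite := by
  refine (Set.finite_range fun z : Fin N × L.bdry => L.ψ z.1 z.2).subset ?_
  rintro x ⟨i, j, y, z, hij, rfl, hz⟩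
  exact ⟨(i, ⟨y, L.mem_bdry_of_ψ_eq hij hz.symm⟩), rfl⟩

/-- A bound of the ranks for the functions `f ∘ ψ_i` is a bound for `f`. -/
lemma rank_densityMatrix_le_of_pull {ι : Type*} [Fintype ι] {R : ℕ∞} {f : ι → C(K, ℝ)}
    (hf : ∀ a, f a ∈ H.dirichletForm.dom)
    (h : ∀ i, ∀ᵐ x ∂ν,
      ((H.dirichletForm.densityMatrix ν (fun a => pull L i (f a)) x).rank : ℕ∞) ≤ R) :
    ∀ᵐ x ∂ν, ((H.dirichletForm.densityMatrix ν f x).rank : ℕ∞) ≤ R := by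
  set O : Set K := {x : K | ∃ i j y z, i ≠ j ∧ L.ψ i y = x ∧ L.ψ j z = x}
  have hO : O.Finite := finite_overlap
  have hO0 : ν O = 0 := by
    rw [← Set.biUnion_of_singleton O, measure_biUnion_null_iff hO.countable]
    exact fun x _ => H.measure_singleton_eq_zero hν x
  set C : Fin N → Set K := fun i => Set.range (L.ψ i) \ O
  have hemb : ∀ i, MeasurableEmbedding (L.ψ i) := fun i =>
    ((L.continuous_ψ i).isClosedEmbedding (L.injective_ψ i)).measurableEmbedding
  have hC : ∀ i, MeasurableSet (C i) := fun i =>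
    (hemb i).measurableSet_range.diff hO.measurableSet
  suffices hmain : ∀ i, ∀ᵐ x ∂(ν.restrict (C i)),
      ((H.dirichletForm.densityMatrix ν f x).rank : ℕ∞) ≤ R by
    have h1 : ∀ᵐ x ∂ν, x ∉ O := measure_eq_zero_iff_ae_notMem.1 hO0
    filter_upwards [h1, ae_all_iff.2 fun i => (ae_restrict_iff' (hC i)).1 (hmain i)] with x hx hx'
    obtain ⟨i, y, hy⟩ := L.exists_ψ_eq x
    exact hx' i ⟨⟨y, hy⟩, hx⟩
  intro i
  -- The part of ν on the cell, off the overlap, read on K. A.e. statements on the cell become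
  -- ρ-a.e. statements.
  set ρ : Measure K := (ν.restrict (C i)).comap (L.ψ i)
  have hρ : ∀ B, MeasurableSet B → ρ B = ν (L.ψ i '' B ∩ C i) := fun B hB => by
    rw [(hemb i).comap_apply, Measure.restrict_apply ((hemb i).measurableSet_image.2 hB)]
  have hρfin : IsFiniteMeasure ρ :=
    ⟨by rw [hρ _ MeasurableSet.univ]; exact measure_lt_top _ _⟩
  have hmap : ρ.map (L.ψ i) = ν.restrict (C i) := by
    rw [(hemb i).map_comap, Measure.restrict_restrict (hemb i).measurableSet_range,
      Set.inter_eq_right.2 Set.sdiff_subset]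
  have hpre : ∀ (B : Set K) j, j ≠ i → L.ψ j ⁻¹' (L.ψ i '' B ∩ C i) = ∅ := by
    intro B j hji
    ext y
    simp only [Set.mem_preimage, Set.mem_empty_iff_false, iff_false]
    rintro ⟨⟨z, -, hz⟩, -, hyO⟩
    exact hyO ⟨j, i, y, z, hji, rfl, hz⟩
  have hprei : ∀ B : Set K, L.ψ i ⁻¹' (L.ψ i '' B ∩ C i) = B ∩ L.ψ i ⁻¹' C i := fun B => by
    rw [Set.preimage_inter, Set.preimage_image_eq _ (L.injective_ψ i)]
  have himg : ∀ B, MeasurableSet B → MeasurableSet (L.ψ i '' B ∩ C i) := fun B hB =>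
    ((hemb i).measurableSet_image.2 hB).inter (hC i)
  -- This lets the ν-a.e. bound for the pull-backs be used ρ-a.e.; it rests on minimality of ν.
  have hac : ρ ≪ ν := by
    refine Measure.AbsolutelyContinuous.mk fun B hB h0 => ?_
    rw [hρ B hB]
    refine H.null_of_preimage_null hν (himg B hB) fun j => ?_
    by_cases hji : j = i
    · rw [hji, hprei]
      exact measure_mono_null Set.inter_subset_left h0
    · rw [hpre B j hji, measure_empty]
  set G : Set K := L.ψ i ⁻¹' C i
  have hG : MeasurableSet G := measurable_ψ i (hC i)
  -- Over B both sides integrate to the mutual energy of ψ_i(B) ∩ C_i. Since the overlap is removed,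
  -- only the i-th term of the self-similar sum survives.
  have hkey : ∀ a b, (fun y => (ρ.rnDeriv ν y).toReal • H.dens ν (f a) (f b) (L.ψ i y)) =ᵐ[ν]
      G.indicator fun y => (H.r i)⁻¹ * H.dens ν (pull L i (f a)) (pull L i (f b)) y := by
    intro a b
    have hint : Integrable (fun y => H.dens ν (f a) (f b) (L.ψ i y)) ρ := by
      have h1 : Integrable (H.dens ν (f a) (f b)) (ρ.map (L.ψ i)) := by
        rw [hmap]
        exact (H.integrable_dens _ _).integrableOn
      exact (hemb i).integrable_map_iff.1 h1
    refine Integrable.ae_eq_of_forall_setIntegral_eq _ _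
      ((integrable_rnDeriv_smul_iff hac).2 hint)
      (((H.integrable_dens _ _).const_mul _).indicator hG) fun B hB _ => ?_
    rw [setIntegral_rnDeriv_smul hac hB, setIntegral_indicator hG, integral_const_mul,
      H.setIntegral_dens hν.domination (H.pull_mem_dom (hf a) i) (H.pull_mem_dom (hf b) i)
        (hB.inter hG)]
    have h1 := (hemb i).setIntegral_map (μ := ρ) (H.dens ν (f a) (f b)) (L.ψ i '' B)
    rw [Set.preimage_image_eq _ (L.injective_ψ i), hmap,
      Measure.restrict_restrict ((hemb i).measurableSet_image.2 hB)] at h1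
    rw [← h1, H.setIntegral_dens hν.domination (hf a) (hf b) (himg B hB),
      H.mm_eq_sum (hf a) (hf b) (himg B hB), Finset.sum_eq_single i]
    · rw [hprei]
    · intro j _ hji
      rw [hpre B j hji]
      simp [mm]
    · simp
  rw [← hmap, (hemb i).ae_map_iff]
  have hkey' : ∀ᵐ y ∂ρ, ∀ a b,
      (ρ.rnDeriv ν y).toReal • H.dens ν (f a) (f b) (L.ψ i y) = G.indicator
        (fun y => (H.r i)⁻¹ * H.dens ν (pull L i (f a)) (pull L i (f b)) y) y :=
    hac.ae_le (ae_all_iff.2 fun a => ae_all_iff.2 fun b => hkey a b)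
  filter_upwards [hkey', Measure.rnDeriv_pos hac, hac.ae_le (Measure.rnDeriv_lt_top ρ ν),
    hac.ae_le (h i)] with y hy hpos hlt hR
  have hθ : 0 < (ρ.rnDeriv ν y).toReal := ENNReal.toReal_pos hpos.ne' hlt.ne
  set θ := (ρ.rnDeriv ν y).toReal
  -- θ > 0 holds ρ-a.e., so it can be divided out. The scalar does not depend on the entry.
  have h2 : H.dirichletForm.densityMatrix ν f (L.ψ i y)
      = (θ⁻¹ * G.indicator (fun _ => (H.r i)⁻¹) y) •
        H.dirichletForm.densityMatrix ν (fun a => pull L i (f a)) y := by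
    ext a b
    have h3 := hy a b
    rw [smul_eq_mul] at h3
    change H.dens ν (f a) (f b) (L.ψ i y) = θ⁻¹ * G.indicator (fun _ => (H.r i)⁻¹) y *
      H.dens ν (pull L i (f a)) (pull L i (f b)) y
    rw [eq_comm, mul_assoc, inv_mul_eq_iff_eq_mul₀ hθ.ne', h3]
    by_cases hyG : y ∈ G <;> simp [hyG]
  rw [h2]
  exact (Nat.cast_le.2 (matrix_rank_smul_le _ _)).trans hR

/-- Bound of the ranks for piecewise harmonic functions. -/
lemma rank_densityMatrix_pharm_le {ι : Type*} [Fintype ι] (m : ℕ) {f : ι → C(K, ℝ)}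
    (hf : ∀ a, f a ∈ H.pharm m) :
    ∀ᵐ x ∂ν, ((H.dirichletForm.densityMatrix ν f x).rank : ℕ∞) ≤
      essSup (fun x => ((H.dirichletForm.densityMatrix ν H.harmonicBasis x).rank : ℕ∞)) ν := by
  induction m generalizing f with
  | zero =>
    have h1 := H.rank_densityMatrix_le_of_span hν.domination (f := f) (b := H.harmonicBasis)
      (fun q => H.harm_le_dom (H.harmonicBasis_mem_harm q)) fun a =>
        (Submodule.mem_span_range_iff_exists_fun ℝ).2
          ⟨fun q => f a q, (H.eq_sum_harmonicBasis (hf a)).symm⟩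
    filter_upwards [h1, ae_le_essSup (μ := ν) (f := fun x =>
      ((H.dirichletForm.densityMatrix ν H.harmonicBasis x).rank : ℕ∞))] with x hx hx'
    exact (Nat.cast_le.2 hx).trans hx'
  | succ m ih =>
    -- The bound is a constant rather than a function of x, so it passes unchanged from the cells to
    -- K.
    exact H.rank_densityMatrix_le_of_pull hν (fun a => H.pharm_le_dom (hf a)) fun i =>
      ih fun a => H.mem_pharm_succ.1 (hf a) i

end MinimalMeasure

/-! ## The pointwise index -/

/-- A basis of the `m`-piecewise harmonic functions. -/
def pharmBasis (H : HarmonicStructure L) (m : ℕ) :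
    Fin (Module.finrank ℝ (H.pharm m)) → C(K, ℝ) :=
  fun k => (Module.finBasis ℝ (H.pharm m) k : C(K, ℝ))

omit [MeasurableSpace K] [BorelSpace K] in
lemma mem_span_pharmBasis (H : HarmonicStructure L) {m : ℕ} {f : C(K, ℝ)} (hf : f ∈ H.pharm m) :
    f ∈ Submodule.span ℝ (Set.range (H.pharmBasis m)) := by
  have h1 : Set.range (H.pharmBasis m)
      = (H.pharm m).subtype '' Set.range (Module.finBasis ℝ (H.pharm m)) := by
    rw [← Set.range_comp]
    rfl
  rw [h1, ← Submodule.map_span, (Module.finBasis ℝ (H.pharm m)).span_eq, Submodule.map_top,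
    Submodule.range_subtype]
  exact hf

omit [MeasurableSpace K] [BorelSpace K] in
lemma pharmBasis_mem_dom (H : HarmonicStructure L) (m : ℕ) (k) :
    H.pharmBasis m k ∈ H.dirichletForm.dom :=
  H.pharm_le_dom (Module.finBasis ℝ (H.pharm m) k).2

/-- A version of the pointwise index, given by the piecewise harmonic functions. -/
def pointwiseIndex (H : HarmonicStructure L) (ν : Measure K) (x : K) : ℕ∞ :=
  ⨆ m, ((H.dirichletForm.densityMatrix ν (H.pharmBasis m) x).rank : ℕ∞)

lemma dominatesRanks_pointwiseIndex (H : HarmonicStructure L) {ν : Measure K} [IsFiniteMeasure ν]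
    (hν : H.dirichletForm.IsEnergyDominant ν) :
    H.dirichletForm.DominatesRanks ν (H.pointwiseIndex ν) := by
  intro n f hf
  choose g hg hgf using fun i => H.exists_pharm_approx (hf i)
  have hgd : ∀ i m, g i m ∈ H.dirichletForm.dom := fun i m => H.pharm_le_dom (hg i m)
  -- All entrywise errors together, so that one a.e. convergent subsequence serves the whole matrix.
  set D : ℕ → K → ℝ := fun m x => ∑ i, ∑ j,
    |H.dens ν (f i) (f j) x - H.dens ν (g i m) (g j m) x|
  have hint : ∀ m i j, Integrable
      (fun x => |H.dens ν (f i) (f j) x - H.dens ν (g i m) (g j m) x|) ν := fun m i j =>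
    ((H.integrable_dens _ _).sub (H.integrable_dens _ _)).abs
  have hDint : ∀ m, Integrable (D m) ν := fun m =>
    integrable_finsetSum _ fun i _ => integrable_finsetSum _ fun j _ => hint m i j
  have hD0 : ∀ m x, 0 ≤ D m x := fun m x =>
    Finset.sum_nonneg fun i _ => Finset.sum_nonneg fun j _ => abs_nonneg _
  have hDlim : Tendsto (fun m => ∫ x, D m x ∂ν) atTop (𝓝 0) := by
    have h1 : ∀ m, ∫ x, D m x ∂ν
        = ∑ i, ∑ j, ∫ x, |H.dens ν (f i) (f j) x - H.dens ν (g i m) (g j m) x| ∂ν := by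
      intro m
      rw [integral_finsetSum _ fun i _ => integrable_finsetSum _ fun j _ => hint m i j]
      exact Finset.sum_congr rfl fun i _ => integral_finsetSum _ fun j _ => hint m i j
    simp_rw [h1]
    have h2 := tendsto_finsetSum (Finset.univ : Finset (Fin n)) fun i _ =>
      tendsto_finsetSum (Finset.univ : Finset (Fin n)) fun j _ =>
        H.tendsto_integral_abs_dens_sub hν (hf i) (hf j) (hgd i) (hgd j) (hgf i) (hgf j)
    simpa using h2
  have hmeas : TendstoInMeasure ν D atTop 0 := by
    refine tendstoInMeasure_of_tendsto_eLpNorm one_ne_zero (fun m => (hDint m).1)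
      aestronglyMeasurable_zero ?_
    have h1 : ∀ m, eLpNorm (D m - 0) 1 ν = ENNReal.ofReal (∫ x, D m x ∂ν) := by
      intro m
      rw [sub_zero, eLpNorm_one_eq_lintegral_enorm,
        ← ofReal_integral_norm_eq_lintegral_enorm (hDint m)]
      congr 1
      exact integral_congr_ae (Eventually.of_forall fun x => Real.norm_of_nonneg (hD0 m x))
    simp_rw [h1]
    simpa using ENNReal.tendsto_ofReal hDlim
  obtain ⟨ns, -, hns⟩ := hmeas.exists_seq_tendsto_ae
  have hrank : ∀ᵐ x ∂ν, ∀ m, (H.dirichletForm.densityMatrix ν (fun i => g i m) x).rank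
      ≤ (H.dirichletForm.densityMatrix ν (H.pharmBasis m) x).rank :=
    ae_all_iff.2 fun m => H.rank_densityMatrix_le_of_span hν (H.pharmBasis_mem_dom m)
      fun i => H.mem_span_pharmBasis (hg i m)
  filter_upwards [hns, hrank] with x hx hxr
  refine matrix_rank_le_of_tendsto
    (A := fun k => H.dirichletForm.densityMatrix ν (fun i => g i (ns k)) x) (fun i j => ?_)
    fun k => (Nat.cast_le.2 (hxr (ns k))).trans (le_iSup (fun m =>
      ((H.dirichletForm.densityMatrix ν (H.pharmBasis m) x).rank : ℕ∞)) (ns k))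
  rw [tendsto_iff_dist_tendsto_zero]
  refine squeeze_zero (fun _ => dist_nonneg) (fun k => ?_) hx
  rw [dist_comm]
  exact (Finset.single_le_sum (f := fun j => |H.dens ν (f i) (f j) x
      - H.dens ν (g i (ns k)) (g j (ns k)) x|) (fun j _ => abs_nonneg _)
      (Finset.mem_univ j)).trans (Finset.single_le_sum (f := fun i => ∑ j, |H.dens ν (f i) (f j) x
      - H.dens ν (g i (ns k)) (g j (ns k)) x|)
      (fun i _ => Finset.sum_nonneg fun j _ => abs_nonneg _) (Finset.mem_univ i))

/-- Minimality is immediate: the supremum involves countably many finite families, each bounded a.e.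
by any competitor. -/
lemma isPointwiseIndex_pointwiseIndex (H : HarmonicStructure L) {ν : Measure K}
    [IsFiniteMeasure ν] (hν : H.dirichletForm.IsEnergyDominant ν) :
    H.dirichletForm.IsPointwiseIndex ν (H.pointwiseIndex ν) where
  measurable := measurable_iSup_enat fun m =>
    (Measurable.of_discrete (f := ((↑) : ℕ → ℕ∞))).comp
      (measurable_matrix_rank fun _ _ => SignedMeasure.measurable_rnDeriv _ _)
  dominates := H.dominatesRanks_pointwiseIndex hν
  minimal p' hp' := by
    filter_upwards [ae_all_iff.2 fun m => hp' _ (H.pharmBasis m) (H.pharmBasis_mem_dom m)] with x hx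
    exact iSup_le hx

lemma essSup_pointwiseIndex (H : HarmonicStructure L) {ν : Measure K} [IsFiniteMeasure ν]
    (hν : H.dirichletForm.IsMinimalEnergyDominant ν) :
    essSup (H.pointwiseIndex ν) ν
      = essSup (fun x => ((H.dirichletForm.densityMatrix ν H.harmonicBasis x).rank : ℕ∞)) ν := by
  refine le_antisymm (essSup_le_of_ae_le _ ?_) (essSup_mono_ae ?_)
  · filter_upwards [ae_all_iff.2 fun m => H.rank_densityMatrix_pharm_le hν m
      (f := H.pharmBasis m) fun k => (Module.finBasis ℝ (H.pharm m) k).2] with x hx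
    exact iSup_le hx
  · filter_upwards [H.rank_densityMatrix_le_of_span hν.domination (f := H.harmonicBasis)
      (H.pharmBasis_mem_dom 0) fun q =>
        H.mem_span_pharmBasis (m := 0) (H.harmonicBasis_mem_harm q)] with x hx
    exact (Nat.cast_le.2 hx).trans (le_iSup (fun m =>
      ((H.dirichletForm.densityMatrix ν (H.pharmBasis m) x).rank : ℕ∞)) 0)

end HarmonicStructure

end

/-- For the form of a regular harmonic structure on a connected p.c.f. self-similar set and a finite
minimal energy-dominant measure `ν`, the index is the `ν`-essential supremum of the rank
of the matrix `(dν_{h_q,h_{q'}}/dν)`, where `q, q' ∈ V₀`. -/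
theorem proposition4p4 {K : Type*} [TopologicalSpace K] [CompactSpace K]
    [TopologicalSpace.MetrizableSpace K] [ConnectedSpace K] [MeasurableSpace K] [BorelSpace K]
    {N : ℕ} (L : PCFStructure K N) (H : HarmonicStructure L)
    (ν : MeasureTheory.Measure K) [MeasureTheory.IsFiniteMeasure ν]
    (hν : H.dirichletForm.IsMinimalEnergyDominant ν) :
    H.dirichletForm.HasIndex ν
      (essSup
        (fun x => ((H.dirichletForm.densityMatrix ν H.harmonicBasis x).rank : ℕ∞)) ν) := by
  exact ⟨H.pointwiseIndex ν, H.isPointwiseIndex_pointwiseIndex hν.domination,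
    H.essSup_pointwiseIndex hν⟩
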